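/- **Setting.** Let $\mathcal X$ and $\mathcal Y$ be arbitrary sets ($\mathcal Y$ may be infinite, even uncountable) and let $\mathcal H\subseteq\mathcal Y^{\mathcal X}$ be non-empty. *Bandit game.* A sequence of labeled instances $(x_1,y_1),(x_2,y_2),\dots\in\mathcal X\times\mathcal Y$ is fixed before the game begins. In round $t$ a (possibly randomized) learner $\mathcal A$ sees $x_t$, predicts $\hat y_t\in\mathcal Y$, and is then told only whether $\hat y_t\neq y_t$. The prediction $\hat y_t$ may depend on the learner's internal randomness, on $x_1,\dots,x_t$, on the learner's earlier predictions, and on the feedback received in rounds $1,\dots,t-1$. The learner does not know the number of rounds. Its worst-case expected regret over $T$ rounds is $$R_{\mathcal A}(T,\mathcal H)=\sup_{(x_1,y_1),\dots,(x_T,y_T)}\ \mathbb E\Big[\sum_{t=1}^T \mathbf 1\{\hat y_t\ne y_t\}-\inf_{h\in\mathcal H}\sum_{t=1}^T\mathbf 1\{h(x_t)\neq y_t\}\Big].$$ The class $\mathcal H$ is *online learnable under bandit feedback* if there is a learner $\mathcal A$ for which $T\mapsto R_{\mathcal A}(T,\mathcal H)$ is non-decreasing and sublinear, that is, $R_{\mathcal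 A}(T,\mathcal H)=o(T)$ as $T\to\infty$. The labels need not be generated by any hypothesis in $\mathcal H$ (the agnostic setting). *Bandit Littlestone dimension.* An $\mathcal X$-valued, $\mathcal Y$-ary tree of depth $d$ is a sequence of functions $\mathcal T_t:\mathcal Y^{t-1}\to\mathcal X$, $t=1,\dots,d$. It is shattered by $\mathcal H$ if for every $(y_1,\dots,y_d)\in\mathcal Y^d$ there is $h\in\mathcal H$ with $h(\mathcal T_t(y_1,\dots,y_{t-1}))\ne y_t$ for all $t\in\{1,\dots,d\}$. The Bandit Littlestone dimension $\mathrm{BL}(\mathcal H)\in\{0,1,2,\dots\}\cup\{\infty\}$ is the largest depth of a tree shattered by $\mathcal H$, and $\infty$ if there are shattered trees of arbitrarily large depth. **Theorem.** The class $\mathcal H$ is online learnable under bandit feedback if and only if $\mathrm{BL}(\mathcal H)<\infty$. -/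

import Mathlib

open MeasureTheory Filter Asymptotics

universe u v w

noncomputable section

/-- A complete `X`-valued, `M`-ary tree of depth `d`, given by its labelling functions: the node
reached from the root along the edges `m_0, …, m_{t-1}` (where `t < d`) is labelled by an
instance. -/
def LabelledTree (X : Type u) (M : Type v) (d : ℕ) : Type (max u v) :=
  (t : Fin d) → (Fin (t : ℕ) → M) → X

/-- The initial segment `(m_0, …, m_{t-1})` of a path `(m_0, …, m_{d-1})`. -/
def pathPrefix {M : Type v} {d : ℕ} (m : Fin d → M) (t : Fin d) : Fin (t : ℕ) → M :=
  fun i => m (Fin.castLE t.isLt.le i)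

/-- The `Y`-ary tree `𝒯` is shattered by `H` in the bandit sense: every path `y` down the tree has
a hypothesis in `H` that disagrees with each edge of the path. -/
def BanditShatters {X : Type u} {Y : Type v} (H : Set (X → Y)) {d : ℕ}
    (𝒯 : LabelledTree X Y d) : Prop :=
  ∀ y : Fin d → Y, ∃ h ∈ H, ∀ t : Fin d, h (𝒯 t (pathPrefix y t)) ≠ y t

/-- The Bandit Littlestone dimension: the largest depth of a bandit-shattered tree, `⊤` if there
are such trees of arbitrarily large depth. -/
def banditLittlestoneDim {X : Type u} {Y : Type v} (H : Set (X → Y)) : ℕ∞ :=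
  ⨆ (d : ℕ) (_ : ∃ 𝒯 : LabelledTree X Y d, BanditShatters H 𝒯), (d : ℕ∞)

/-- A (potentially randomized) bandit learner. It draws an internal random seed `ω`. In each round
it predicts a label from the seed, the past instances together with the bandit feedback received
for them (`true` for a mistake, `false` for a correct prediction; oldest round first), and the
current instance. Its own past predictions are determined by these data, so they need not be
listed. The label space carries no structure: the only measurability required is that
predicting any given label is an event. The learner is not told the number of rounds. -/
structure BanditLearner (X : Type u) (Y : Type v) where
  /-- the space of random seeds -/
  Ω : Type w
  /-- the events -/
  mΩ : MeasurableSpace Ω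
  /-- the law of the seed -/
  μ : Measure Ω
  isProb : IsProbabilityMeasure μ
  /-- the predicted label -/
  predict : Ω → List (X × Bool) → X → Y
  measurableSet_predict : ∀ (past : List (X × Bool)) (x : X) (y : Y),
    MeasurableSet {ω | predict ω past x = y}

attribute [instance] BanditLearner.mΩ BanditLearner.isProb

namespace BanditLearner

variable {X : Type u} {Y : Type v} (A : BanditLearner.{u, v, w} X Y)

open Classical in
/-- What the learner with seed `ω` has observed before round `t` (rounds are numbered from `0`)
when it plays against the labelled stream `S`. -/
def observed (S : ℕ → X × Y) (ω : A.Ω) : ℕ → List (X × Bool)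
  | 0 => []
  | t + 1 => observed S ω t ++
      [((S t).1, decide (A.predict ω (observed S ω t) (S t).1 ≠ (S t).2))]

/-- The prediction in round `t` against the labelled stream `S`. -/
def prediction (S : ℕ → X × Y) (t : ℕ) (ω : A.Ω) : Y :=
  A.predict ω (A.observed S ω t) (S t).1

open Classical in
/-- The expected regret over the first `T` rounds of the labelled stream `S`, which is fixed before
the game begins. -/
def expectedRegret (H : Set (X → Y)) (S : ℕ → X × Y) (T : ℕ) : ℝ :=
  ∫ ω, ((∑ t ∈ Finset.range T, if A.prediction S t ω ≠ (S t).2 then (1 : ℝ) else 0)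
    - ⨅ h : H, ∑ t ∈ Finset.range T, if h.1 (S t).1 ≠ (S t).2 then (1 : ℝ) else 0) ∂A.μ

/-- The worst-case expected regret over `T` rounds (a supremum of numbers that are at most `T`). -/
def regret (H : Set (X → Y)) (T : ℕ) : ℝ :=
  ⨆ S : ℕ → X × Y, A.expectedRegret H S T

end BanditLearner

/-- Agnostic online learnability under bandit feedback: some learner has a non-decreasing,
sublinear worst-case expected regret. -/
def BanditOnlineLearnable {X : Type u} {Y : Type v} (H : Set (X → Y)) : Prop :=
  ∃ A : BanditLearner.{u, v, w} X Y,
    Monotone (A.regret H) ∧ (A.regret H) =o[atTop] (fun T : ℕ => (T : ℝ))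

end

/-!
**Finite dimension implies learnability.** If no tree of depth `D` is shattered, then each instance
takes at most `D` labels under the class (`encard_image_eval_le`), and at each instance some label
has the property that ruling it out lowers the depth bound. The bandit standard optimal algorithm
predicts that label, so it disagrees at most `D` times with any fixed hypothesis if it updates
exactly in the rounds of disagreement. Hence in a block of `n` rounds the `(n + 1) ^ D` experts
which run this algorithm with a prescribed set of at most `D` update rounds contain, for each
hypothesis, one that errs at most `D` times more (`exists_update_rounds`). Exponential weights over
these experts with importance-weighted losses of the drawn label have expected regret of order
`log (#experts) / η + η D n`: the number of labels enters, but it is at most `D`. The analysis is a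
one-round inequality for the potential `log (total weight / weight of the expert) / η`
(`sum_adviceShare_mul_le`), integrated over independent round seeds. As the horizon is unknown, the
algorithm restarts at every square round; epoch `k` has `2 * k + 1` rounds and regret `o(k)`, so the
first `√T` epochs contribute `o(T)`.

**Learnability implies finite dimension.** A learner with regret below `T / 2` for some `T` bounds
both the number of labels per instance, by `2 * T` (a constant stream with a label that the learner
is unlikely to try), and the full-information Littlestone dimension, by `T` (on a binary tree the
adversary follows the less likely label). These two bounds force a finite bandit Littlestone
dimension (`exists_not_shattersDepth`): a weighted majority vote over version spaces, split at each
instance according to the label, loses a fixed fraction of its weight whenever the heaviest label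
is excluded.

The regret of every learner is non-decreasing in the horizon (`monotone_regret`), because the
adversary may continue with the labels of a currently optimal hypothesis.
-/

/-! ### Shattering by recursion on the depth -/

/-- `H` bandit-shatters some tree of depth `d`, by recursion on the depth: some root `x` is such
that for each label `y` the hypotheses avoiding `y` at `x` shatter a tree of depth `d - 1`. -/
def ShattersDepth {X : Type u} {Y : Type v} : Set (X → Y) → ℕ → Prop
  | V, 0 => V.Nonempty
  | V, d + 1 => ∃ x, ∀ y, ShattersDepth {h ∈ V | h x ≠ y} d

/-- `H` shatters some complete binary tree of depth `d` in the sense of the (full-information)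
multiclass Littlestone dimension: each node carries an instance and two distinct labels for its
two edges, and every branch is realized by a hypothesis. -/
def LittlestoneShatters {X : Type u} {Y : Type v} : Set (X → Y) → ℕ → Prop
  | V, 0 => V.Nonempty
  | V, d + 1 => ∃ x y₀ y₁, y₀ ≠ y₁ ∧
      LittlestoneShatters {h ∈ V | h x = y₀} d ∧ LittlestoneShatters {h ∈ V | h x = y₁} d

section Shattering

variable {X : Type u} {Y : Type v}

theorem exists_banditShatters_iff (V : Set (X → Y)) (d : ℕ) :
    (∃ 𝒯 : LabelledTree X Y d, BanditShatters V 𝒯) ↔ ShattersDepth V d := by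
  induction d generalizing V with
  | zero =>
    constructor
    · rintro ⟨𝒯, h𝒯⟩
      obtain ⟨h, hV, -⟩ := h𝒯 Fin.elim0
      exact ⟨h, hV⟩
    · rintro ⟨h, hV⟩
      exact ⟨fun t => t.elim0, fun y => ⟨h, hV, fun t => t.elim0⟩⟩
  | succ d ih =>
    constructor
    · rintro ⟨𝒯, h𝒯⟩
      refine ⟨𝒯 0 Fin.elim0, fun y => (ih _).1 ⟨fun s p => 𝒯 s.succ (Fin.cons y p), fun q => ?_⟩⟩
      obtain ⟨h, hV, hq⟩ := h𝒯 (Fin.cons y q)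
      refine ⟨h, ⟨hV, ?_⟩, fun t => ?_⟩
      · have h0 := hq 0
        rwa [show pathPrefix (Fin.cons y q : Fin (d + 1) → Y) 0 = Fin.elim0 from
          funext fun i => i.elim0] at h0
      · have ht := hq t.succ
        rw [show pathPrefix (Fin.cons y q : Fin (d + 1) → Y) t.succ
            = (Fin.cons y (pathPrefix q t) : Fin ((t : ℕ) + 1) → Y) from
          funext fun i => by
            refine Fin.cases ?_ (fun j => ?_) i
            · rfl
            · rfl] at ht
        simpa using ht
    · rintro ⟨x, hx⟩
      choose 𝒯 h𝒯 using fun y => (ih _).2 (hx y)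
      refine ⟨fun t => Fin.cases (motive := fun t : Fin (d + 1) => (Fin (t : ℕ) → Y) → X)
        (fun _ => x) (fun s (p : Fin ((s : ℕ) + 1) → Y) => 𝒯 (p 0) s fun i => p i.succ) t,
        fun y => ?_⟩
      obtain ⟨h, ⟨hV, h0⟩, ht⟩ := h𝒯 (y 0) (fun i => y i.succ)
      refine ⟨h, hV, fun t => ?_⟩
      refine Fin.cases ?_ (fun s => ?_) t
      · exact h0
      · exact ht s

theorem ShattersDepth.of_succ {V : Set (X → Y)} {d : ℕ} (hY : X → Nonempty Y)
    (h : ShattersDepth V (d + 1)) : ShattersDepth V d := by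
  induction d generalizing V with
  | zero =>
    obtain ⟨x, hx⟩ := h
    obtain ⟨y⟩ := hY x
    obtain ⟨g, hg⟩ := hx y
    exact ⟨g, hg.1⟩
  | succ d ih =>
    obtain ⟨x, hx⟩ := h
    exact ⟨x, fun y => ih (hx y)⟩

theorem ShattersDepth.antitone {V : Set (X → Y)} (hY : X → Nonempty Y) :
    Antitone (ShattersDepth V) :=
  antitone_nat_of_succ_le fun _ h => h.of_succ hY

theorem banditLittlestoneDim_lt_top_iff {H : Set (X → Y)} (hH : H.Nonempty) :
    banditLittlestoneDim H < ⊤ ↔ ∃ D, ¬ ShattersDepth H D := by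
  have hY : X → Nonempty Y := fun x => ⟨hH.some x⟩
  unfold banditLittlestoneDim
  simp only [exists_banditShatters_iff]
  constructor
  · intro h
    by_contra! hall
    refine h.ne (ENat.eq_top_iff_forall_ge.2 fun n => ?_)
    exact le_iSup₂_of_le n (hall n) le_rfl
  · rintro ⟨D, hD⟩
    refine lt_of_le_of_lt (iSup₂_le (a := (D : ℕ∞)) fun d hd => ?_) (ENat.natCast_lt_top D)
    by_contra! hlt
    exact hD (ShattersDepth.antitone hY (by exact_mod_cast hlt.le) hd)

/-- Repeating one instance `x` along a whole tree shows that `x` can take few labels. -/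
theorem encard_image_eval_le {V : Set (X → Y)} {m : ℕ} (h : ¬ ShattersDepth V m) (x : X) :
    ((fun g : X → Y => g x) '' V).encard ≤ m := by
  induction m generalizing V with
  | zero =>
    have : V = ∅ := Set.not_nonempty_iff_eq_empty.1 h
    simp [this]
  | succ m ih =>
    obtain ⟨y, hy⟩ : ∃ y, ¬ ShattersDepth {h ∈ V | h x ≠ y} m := by
      by_contra! hall
      exact h ⟨x, hall⟩
    have hsub : (fun g : X → Y => g x) '' V
        ⊆ insert y ((fun g : X → Y => g x) '' {h ∈ V | h x ≠ y}) := by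
      rintro _ ⟨g, hg, rfl⟩
      by_cases hgy : g x = y
      · exact Or.inl hgy
      · exact Or.inr ⟨g, ⟨hg, hgy⟩, rfl⟩
    calc _ ≤ _ := Set.encard_le_encard hsub
      _ ≤ _ := Set.encard_insert_le _ _
      _ ≤ _ := by push_cast; gcongr; exact ih hy

theorem ShattersDepth.mono {V W : Set (X → Y)} (hVW : V ⊆ W) {d : ℕ} (h : ShattersDepth V d) :
    ShattersDepth W d := by
  induction d generalizing V W with
  | zero => exact Set.Nonempty.mono hVW h
  | succ d ih =>
    obtain ⟨x, hx⟩ := h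
    exact ⟨x, fun y => ih (fun g hg => ⟨hVW hg.1, hg.2⟩) (hx y)⟩

theorem LittlestoneShatters.mono {V W : Set (X → Y)} (hVW : V ⊆ W) {d : ℕ}
    (h : LittlestoneShatters V d) : LittlestoneShatters W d := by
  induction d generalizing V W with
  | zero => exact Set.Nonempty.mono hVW h
  | succ d ih =>
    obtain ⟨x, y₀, y₁, hne, h₀, h₁⟩ := h
    exact ⟨x, y₀, y₁, hne, ih (fun g hg => ⟨hVW hg.1, hg.2⟩) h₀,
      ih (fun g hg => ⟨hVW hg.1, hg.2⟩) h₁⟩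

/-! ### From Littlestone to bandit shattering -/

/-- The union of the version spaces in a list of pairs (version space, rank). -/
def versionUnion (l : List (Set (X → Y) × ℕ)) : Set (X → Y) := {g | ∃ p ∈ l, g ∈ p.1}

/-- The total weight `∑ B ^ rank` of a list of pairs (version space, rank). -/
noncomputable def totalWeight (B : ℝ) (l : List (Set (X → Y) × ℕ)) : ℝ :=
  (l.map fun p => B ^ p.2).sum

open Classical in
/-- The part of a version space of rank at most `ℓ` on which `h x = y`, with an upper bound for
its rank: the rank drops by one unless `y` is the label kept by the standard optimal algorithm. -/
noncomputable def splitAt (x : X) (y : Y) (p : Set (X → Y) × ℕ) : Set (X → Y) × ℕ :=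
  ({h ∈ p.1 | h x = y},
    if LittlestoneShatters {h ∈ p.1 | h x = y} (p.2 - 1) then p.2 else p.2 - 1)

theorem not_littlestoneShatters_splitAt {x : X} {y : Y} {p : Set (X → Y) × ℕ}
    (hp : ¬ LittlestoneShatters p.1 p.2) :
    ¬ LittlestoneShatters (splitAt x y p).1 (splitAt x y p).2 := by
  unfold splitAt
  dsimp only
  split_ifs with h
  · exact fun h' => hp (h'.mono fun g hg => hg.1)
  · exact h

/-- At most one of the parts keeps its rank; the other ones weigh a factor `B` less. -/
theorem sum_splitAt_le {B : ℝ} (hB : 1 ≤ B) (x : X) (F : Finset Y) {p : Set (X → Y) × ℕ}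
    (hp : ¬ LittlestoneShatters p.1 p.2) (hp0 : p.2 ≠ 0) (hF : F.Nonempty) :
    ∑ y ∈ F, B ^ (splitAt x y p).2 ≤ (1 + (F.card - 1) / B) * B ^ p.2 := by
  classical
  obtain ⟨V, ℓ⟩ := p
  obtain ⟨ℓ, rfl⟩ := Nat.exists_eq_succ_of_ne_zero hp0
  have hB0 : (0 : ℝ) < B := by linarith
  have hcard : (1 : ℝ) ≤ F.card := by exact_mod_cast hF.card_pos
  have hR : (1 + (F.card - 1) / B) * B ^ (ℓ + 1) = B ^ (ℓ + 1) + ((F.card : ℝ) - 1) * B ^ ℓ := by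
    field_simp
    ring
  have hle : B ^ ℓ ≤ B ^ (ℓ + 1) := pow_le_pow_right₀ hB (Nat.le_succ _)
  simp only [Nat.succ_eq_add_one] at hp ⊢
  rw [hR]
  by_cases h : ∃ y₀ ∈ F, LittlestoneShatters {h ∈ V | h x = y₀} ℓ
  · obtain ⟨y₀, hy₀F, hy₀⟩ := h
    rw [← Finset.add_sum_erase _ _ hy₀F]
    have hne : ∀ y ∈ F.erase y₀, B ^ (splitAt x y (V, ℓ + 1)).2 = B ^ ℓ := by
      intro y hy
      have : ¬ LittlestoneShatters {h ∈ V | h x = y} ℓ := fun h' =>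
        hp ⟨x, y₀, y, (Finset.ne_of_mem_erase hy).symm, hy₀, h'⟩
      simp [splitAt, this]
    rw [Finset.sum_congr rfl hne, Finset.sum_const, nsmul_eq_mul, Finset.card_erase_of_mem hy₀F,
      Nat.cast_sub hF.card_pos, Nat.cast_one]
    simp [splitAt, hy₀]
  · push Not at h
    have hne : ∀ y ∈ F, B ^ (splitAt x y (V, ℓ + 1)).2 = B ^ ℓ := by
      intro y hy
      simp [splitAt, h y hy]
    rw [Finset.sum_congr rfl hne, Finset.sum_const, nsmul_eq_mul]
    nlinarith

theorem totalWeight_flatMap (B : ℝ) (F : Finset Y) (g : Y → List (Set (X → Y) × ℕ)) :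
    totalWeight B (F.toList.flatMap g) = ∑ y ∈ F, totalWeight B (g y) := by
  rw [← Finset.sum_map_toList]
  unfold totalWeight
  induction F.toList with
  | nil => simp
  | cons a l ih => simp [ih]

theorem sum_totalWeight_splitAt_le {B : ℝ} (hB : 1 ≤ B) (x : X) (F : Finset Y)
    (hF : F.Nonempty) (l : List (Set (X → Y) × ℕ))
    (hl : ∀ p ∈ l, ¬ LittlestoneShatters p.1 p.2 ∧ p.2 ≠ 0) :
    ∑ y ∈ F, totalWeight B (l.map (splitAt x y)) ≤ (1 + (F.card - 1) / B) * totalWeight B l := by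
  induction l with
  | nil => simp [totalWeight]
  | cons p l ih =>
    have h1 := sum_splitAt_le hB x F (hl p (by simp)).1 (hl p (by simp)).2 hF
    have h2 := ih fun q hq => hl q (by simp [hq])
    simp only [totalWeight, List.map_cons, List.sum_cons, Finset.sum_add_distrib, mul_add] at h2 ⊢
    linarith

/-- The weighted-majority argument: removing at each instance the heaviest label leaves at most a
`1 - 1 / K ^ 2` fraction of the weight, so light lists of version spaces shatter no deep tree. -/
theorem not_shattersDepth_versionUnion [Nonempty Y] {K : ℕ} (hK : 1 ≤ K) (d : ℕ)
    (l : List (Set (X → Y) × ℕ))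
    (hl : ∀ p ∈ l, ¬ LittlestoneShatters p.1 p.2)
    (hcard : ∀ x, ((fun g : X → Y => g x) '' versionUnion l).encard ≤ K)
    (hw : (1 - 1 / (K : ℝ) ^ 2) ^ d * totalWeight ((K : ℝ) ^ 2) l < 1) :
    ¬ ShattersDepth (versionUnion l) d := by
  classical
  have hK' : (1 : ℝ) ≤ K := by exact_mod_cast hK
  have hB : (1 : ℝ) ≤ (K : ℝ) ^ 2 := one_le_pow₀ hK'
  have hB0 : (0 : ℝ) < (K : ℝ) ^ 2 := by positivity
  have hwnonneg : ∀ l' : List (Set (X → Y) × ℕ), 0 ≤ totalWeight ((K : ℝ) ^ 2) l' := by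
    intro l'
    refine List.sum_nonneg fun a ha => ?_
    obtain ⟨p, -, rfl⟩ := List.mem_map.1 ha
    positivity
  have hr : (0 : ℝ) ≤ 1 - 1 / (K : ℝ) ^ 2 := by
    rw [sub_nonneg, div_le_one hB0]; exact hB
  induction d generalizing l with
  | zero =>
    rintro ⟨g, p, hp, hg⟩
    simp only [pow_zero, one_mul] at hw
    have h1 : (1 : ℝ) ≤ ((K : ℝ) ^ 2) ^ p.2 := one_le_pow₀ hB
    have h2 : ((K : ℝ) ^ 2) ^ p.2 ≤ totalWeight ((K : ℝ) ^ 2) l :=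
      List.single_le_sum (l := l.map fun p => ((K : ℝ) ^ 2) ^ p.2)
        (fun a ha => by obtain ⟨q, -, rfl⟩ := List.mem_map.1 ha; positivity) _
        (List.mem_map.2 ⟨p, hp, rfl⟩)
    linarith
  | succ d ih =>
    rintro ⟨x, hx⟩
    -- Version spaces of rank `0` are empty, so they may be dropped.
    set l' := l.filter fun p => p.2 ≠ 0 with hl'
    have hl'w : totalWeight ((K : ℝ) ^ 2) l' ≤ totalWeight ((K : ℝ) ^ 2) l := by
      refine List.Sublist.sum_le_sum (List.Sublist.map _ List.filter_sublist) fun a ha => ?_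
      obtain ⟨q, -, rfl⟩ := List.mem_map.1 ha
      positivity
    have hl'p : ∀ p ∈ l', ¬ LittlestoneShatters p.1 p.2 ∧ p.2 ≠ 0 := fun p hp => by
      rw [hl', List.mem_filter] at hp
      exact ⟨hl p hp.1, by simpa using hp.2⟩
    have hunion : ∀ g ∈ versionUnion l, ∃ p ∈ l', g ∈ p.1 := by
      rintro g ⟨p, hp, hg⟩
      refine ⟨p, List.mem_filter.2 ⟨hp, ?_⟩, hg⟩
      by_contra h0
      simp only [ne_eq, decide_not, Bool.not_eq_eq_eq_not, Bool.not_true, decide_eq_false_iff_not,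
        not_not] at h0
      have := hl p hp
      rw [h0] at this
      exact this ⟨g, hg⟩
    have hfin : ((fun g : X → Y => g x) '' versionUnion l).Finite :=
      Set.finite_of_encard_le_coe (hcard x)
    set F : Finset Y := hfin.toFinset with hFdef
    have hFK : (F.card : ℝ) ≤ K := by
      have := hcard x
      rw [hfin.encard_eq_coe_toFinset_card] at this
      exact_mod_cast this
    have hmemF : ∀ g ∈ versionUnion l, g x ∈ F := fun g hg => by
      rw [hFdef, Set.Finite.mem_toFinset]; exact ⟨g, hg, rfl⟩
    by_cases hF : F.Nonempty
    swap
    · -- No labels at all: the union is empty.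
      have hempty : ∀ g, g ∉ versionUnion l := fun g hg => hF ⟨_, hmemF g hg⟩
      refine ih [] (by simp) (by simp [versionUnion]) (by simp [totalWeight]) ?_
      exact (hx (Classical.arbitrary Y)).mono fun g hg => absurd hg.1 (hempty g)
    set w : Y → ℝ := fun y => totalWeight ((K : ℝ) ^ 2) (l'.map (splitAt x y)) with hwdef
    obtain ⟨y, hyF, hymax⟩ := F.exists_max_image w hF
    set rest := (F.erase y).toList.flatMap fun z => l'.map (splitAt x z) with hrest
    have hmem : ∀ p ∈ rest, ∃ q ∈ l', ∃ z, p = splitAt x z q := by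
      intro p hp
      obtain ⟨z, -, hz⟩ := List.mem_flatMap.1 hp
      obtain ⟨q, hq, rfl⟩ := List.mem_map.1 hz
      exact ⟨q, hq, z, rfl⟩
    have hsub : versionUnion rest ⊆ versionUnion l := by
      rintro g ⟨p, hp, hg⟩
      obtain ⟨q, hq, z, rfl⟩ := hmem p hp
      exact ⟨q, List.mem_of_mem_filter hq, hg.1⟩
    have hsub' : {g ∈ versionUnion l | g x ≠ y} ⊆ versionUnion rest := by
      rintro g ⟨hg, hgy⟩
      obtain ⟨p, hp, hgp⟩ := hunion g hg
      refine ⟨splitAt x (g x) p, List.mem_flatMap.2 ⟨g x, ?_, List.mem_map_of_mem hp⟩, hgp, rfl⟩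
      rw [Finset.mem_toList]
      exact Finset.mem_erase.2 ⟨hgy, hmemF g hg⟩
    refine ih rest ?_ (fun z => (Set.encard_le_encard (Set.image_mono hsub)).trans (hcard z)) ?_
      ((hx y).mono hsub')
    · intro p hp
      obtain ⟨q, hq, z, rfl⟩ := hmem p hp
      exact not_littlestoneShatters_splitAt (hl'p q hq).1
    · refine lt_of_le_of_lt ?_ hw
      rw [pow_succ _ d, mul_assoc]
      refine mul_le_mul_of_nonneg_left ?_ (pow_nonneg hr d)
      refine le_trans ?_ (mul_le_mul_of_nonneg_left hl'w hr)
      have hn1 : (1 : ℝ) ≤ F.card := by exact_mod_cast hF.card_pos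
      have hS : ∑ z ∈ F, w z ≤ (1 + (F.card - 1) / (K : ℝ) ^ 2) * totalWeight ((K : ℝ) ^ 2) l' :=
        sum_totalWeight_splitAt_le hB x F hF l' hl'p
      have hrw : totalWeight ((K : ℝ) ^ 2) rest = ∑ z ∈ F, w z - w y := by
        rw [hrest, totalWeight_flatMap, ← Finset.add_sum_erase F w hyF]
        ring
      have hmax : (∑ z ∈ F, w z) / F.card ≤ w y := by
        rw [div_le_iff₀ (by linarith), mul_comm, ← nsmul_eq_mul]
        exact Finset.sum_le_card_nsmul _ _ _ hymax
      have hS0 : 0 ≤ ∑ z ∈ F, w z := Finset.sum_nonneg fun z _ => hwnonneg _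
      have hW0 := hwnonneg l'
      have hd : (∑ z ∈ F, w z) / K ≤ (∑ z ∈ F, w z) / F.card :=
        div_le_div_of_nonneg_left hS0 (by linarith) hFK
      have hS2 : ∑ z ∈ F, w z ≤ (1 + ((K : ℝ) - 1) / (K : ℝ) ^ 2) * totalWeight ((K : ℝ) ^ 2) l' :=
        hS.trans (mul_le_mul_of_nonneg_right (by gcongr) hW0)
      have hq0 : 0 ≤ 1 - 1 / (K : ℝ) := by
        rw [sub_nonneg, div_le_one (by linarith)]; exact hK'
      calc totalWeight ((K : ℝ) ^ 2) rest ≤ (1 - 1 / (K : ℝ)) * ∑ z ∈ F, w z := by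
            rw [hrw, sub_mul, one_mul, one_div_mul_eq_div]; linarith
        _ ≤ (1 - 1 / (K : ℝ)) *
              ((1 + ((K : ℝ) - 1) / (K : ℝ) ^ 2) * totalWeight ((K : ℝ) ^ 2) l') :=
            mul_le_mul_of_nonneg_left hS2 hq0
        _ ≤ (1 - 1 / (K : ℝ) ^ 2) * totalWeight ((K : ℝ) ^ 2) l' := by
            rw [← mul_assoc]
            refine mul_le_mul_of_nonneg_right ?_ hW0
            have hKne : (K : ℝ) ≠ 0 := by linarith
            rw [← sub_nonneg]
            -- Dropping the heaviest label gains `1 - 1 / K`, more than splitting can lose.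
            have : 1 - 1 / (K : ℝ) ^ 2 - (1 - 1 / (K : ℝ)) * (1 + ((K : ℝ) - 1) / (K : ℝ) ^ 2)
                = ((K : ℝ) - 1) / (K : ℝ) ^ 3 := by
              field_simp
              ring
            rw [this]
            exact div_nonneg (by linarith) (by positivity)

/-- For classes with boundedly many labels at each instance, a finite Littlestone dimension forces
a finite bandit Littlestone dimension. -/
theorem exists_not_shattersDepth [Nonempty Y] {H : Set (X → Y)} {K ℓ : ℕ} (hK : 1 ≤ K)
    (hcard : ∀ x, ((fun g : X → Y => g x) '' H).encard ≤ K) (hℓ : ¬ LittlestoneShatters H ℓ) :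
    ∃ D, ¬ ShattersDepth H D := by
  have hK' : (1 : ℝ) ≤ K := by exact_mod_cast hK
  have hB : (1 : ℝ) ≤ (K : ℝ) ^ 2 := one_le_pow₀ hK'
  have hr0 : 0 ≤ 1 - 1 / (K : ℝ) ^ 2 := by
    rw [sub_nonneg, div_le_one (by positivity)]; exact hB
  have hr1 : 1 - 1 / (K : ℝ) ^ 2 < 1 := sub_lt_self _ (by positivity)
  have hlim : Tendsto (fun d : ℕ => (1 - 1 / (K : ℝ) ^ 2) ^ d * ((K : ℝ) ^ 2) ^ ℓ) atTop
      (nhds (0 * ((K : ℝ) ^ 2) ^ ℓ)) :=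
    (tendsto_pow_atTop_nhds_zero_of_lt_one hr0 hr1).mul_const _
  rw [zero_mul] at hlim
  obtain ⟨D, hD⟩ := (hlim.eventually_lt_const one_pos).exists
  have hU : versionUnion [(H, ℓ)] = H := by
    ext g; simp [versionUnion]
  refine ⟨D, ?_⟩
  have := not_shattersDepth_versionUnion hK D [(H, ℓ)] (by simpa using hℓ) (by rwa [hU])
    (by simpa [totalWeight] using hD)
  rwa [hU] at this

end Shattering

/-! ### Functions with finitely many values and measurable fibres -/

/-- `f` takes finitely many values, each of them on an `m`-measurable set. The codomain carries no
structure; the σ-algebra is explicit because several of them on the same space are used. -/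
def IsSimple {Ω : Type*} {β : Type*} (m : MeasurableSpace Ω) (f : Ω → β) : Prop :=
  (Set.range f).Finite ∧ ∀ b, MeasurableSet[m] (f ⁻¹' {b})

namespace IsSimple

variable {Ω : Type*} {β γ : Type*} {m m' : MeasurableSpace Ω} {f : Ω → β}

theorem const (m : MeasurableSpace Ω) (b : β) : IsSimple m (fun _ : Ω => b) :=
  ⟨Set.finite_range_const, fun _ => MeasurableSet.const _⟩

theorem bind (hf : IsSimple m f) {g : β → Ω → γ} (hg : ∀ b, IsSimple m (g b)) :
    IsSimple m (fun ω => g (f ω) ω) := by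
  constructor
  · refine (hf.1.biUnion fun b _ => (hg b).1).subset ?_
    rintro _ ⟨ω, rfl⟩
    simp only [Set.mem_iUnion]
    exact ⟨f ω, ⟨ω, rfl⟩, ω, rfl⟩
  · intro c
    have : (fun ω => g (f ω) ω) ⁻¹' {c} = ⋃ b ∈ Set.range f, f ⁻¹' {b} ∩ g b ⁻¹' {c} := by
      ext ω
      simp only [Set.mem_preimage, Set.mem_singleton_iff, Set.mem_iUnion, Set.mem_inter_iff]
      exact ⟨fun h => ⟨f ω, ⟨ω, rfl⟩, rfl, h⟩, fun ⟨b, _, hb, h⟩ => hb ▸ h⟩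
    rw [this]
    exact hf.1.measurableSet_biUnion fun b _ => (hf.2 b).inter ((hg b).2 c)

theorem comp (hf : IsSimple m f) (φ : β → γ) : IsSimple m (fun ω => φ (f ω)) :=
  hf.bind (g := fun b _ => φ b) fun b => const m (φ b)

theorem of_measurableSet {p : Ω → Prop} [DecidablePred p] (hp : MeasurableSet[m] {ω | p ω}) :
    IsSimple m (fun ω => decide (p ω)) := by
  refine ⟨Set.toFinite _, fun b => ?_⟩
  cases b with
  | true =>
    convert hp using 1
    ext ω; simp
  | false =>
    convert hp.compl using 1
    ext ω; simp

theorem of_measurable [Finite β] [MeasurableSpace β] [MeasurableSingletonClass β]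
    (hf : Measurable[m] f) : IsSimple m f :=
  ⟨Set.toFinite _, fun b => hf (measurableSet_singleton b)⟩

theorem mono (hf : IsSimple m f) (hm : m ≤ m') : IsSimple m' f :=
  ⟨hf.1, fun b => hm _ (hf.2 b)⟩

theorem integrable {f : Ω → ℝ} (hf : IsSimple m f) (μ : Measure[m] Ω) [IsFiniteMeasure μ] :
    Integrable f μ :=
  (⟨f, hf.2, hf.1⟩ : SimpleFunc Ω ℝ).integrable_of_isFiniteMeasure

end IsSimple

/-! ### Regret of an arbitrary learner -/

open Classical in
/-- The number of mistakes of the hypothesis `h` in the first `T` rounds of `S`. -/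
noncomputable def hypothesisLoss {X : Type u} {Y : Type v} (S : ℕ → X × Y) (h : X → Y)
    (T : ℕ) : ℝ :=
  ∑ t ∈ Finset.range T, if h (S t).1 ≠ (S t).2 then (1 : ℝ) else 0

namespace BanditLearner

variable {X : Type u} {Y : Type v} (A : BanditLearner.{u, v, w} X Y)

/-- The probability of a mistake in round `t`. -/
noncomputable def mistakeProb (S : ℕ → X × Y) (t : ℕ) : ℝ :=
  A.μ.real {ω | A.prediction S t ω ≠ (S t).2}

theorem isSimple_observed (S : ℕ → X × Y) (t : ℕ) :
    IsSimple A.mΩ (fun ω => A.observed S ω t) := by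
  classical
  induction t with
  | zero => exact IsSimple.const _ _
  | succ t ih =>
    refine ih.bind (g := fun l ω => l ++
      [((S t).1, decide (A.predict ω l (S t).1 ≠ (S t).2))]) fun l => ?_
    exact (IsSimple.of_measurableSet (p := fun ω => A.predict ω l (S t).1 ≠ (S t).2)
      (A.measurableSet_predict l _ _).compl).comp fun b => l ++ [((S t).1, b)]

theorem measurableSet_mistake (S : ℕ → X × Y) (t : ℕ) :
    MeasurableSet {ω | A.prediction S t ω ≠ (S t).2} := by
  classical
  have h := (A.isSimple_observed S t).bind
    (g := fun l ω => decide (A.predict ω l (S t).1 ≠ (S t).2)) fun l =>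
      IsSimple.of_measurableSet (p := fun ω => A.predict ω l (S t).1 ≠ (S t).2)
        (A.measurableSet_predict l _ _).compl
  convert h.2 true using 1
  ext ω
  simp [prediction]

open Classical in
theorem mistakeProb_eq_integral (S : ℕ → X × Y) (t : ℕ) :
    A.mistakeProb S t = ∫ ω, (if A.prediction S t ω ≠ (S t).2 then (1 : ℝ) else 0) ∂A.μ := by
  rw [mistakeProb, ← integral_indicator_one (A.measurableSet_mistake S t)]
  congr 1
  ext ω
  simp [Set.indicator_apply]

theorem expectedRegret_eq (H : Set (X → Y)) (S : ℕ → X × Y) (T : ℕ) :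
    A.expectedRegret H S T
      = ∑ t ∈ Finset.range T, A.mistakeProb S t - ⨅ h : H, hypothesisLoss S h.1 T := by
  classical
  have hint : ∀ t ∈ Finset.range T,
      Integrable (fun ω => if A.prediction S t ω ≠ (S t).2 then (1 : ℝ) else 0) A.μ := fun t _ =>
    ((integrable_const (1 : ℝ)).indicator (A.measurableSet_mistake S t)).congr
      (Eventually.of_forall fun ω => by simp [Set.indicator_apply])
  unfold expectedRegret
  rw [integral_sub (integrable_finsetSum _ hint) (integrable_const _), integral_finsetSum _ hint]
  simp only [mistakeProb_eq_integral, integral_const, probReal_univ, one_smul]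
  rfl

theorem mistakeProb_nonneg (S : ℕ → X × Y) (t : ℕ) : 0 ≤ A.mistakeProb S t := measureReal_nonneg

end BanditLearner

section Regret

variable {X : Type u} {Y : Type v} {S S' : ℕ → X × Y} {H : Set (X → Y)}

theorem hypothesisLoss_nonneg (S : ℕ → X × Y) (h : X → Y) (T : ℕ) : 0 ≤ hypothesisLoss S h T :=
  Finset.sum_nonneg fun _ _ => by split_ifs <;> simp

theorem bddBelow_hypothesisLoss (S : ℕ → X × Y) (H : Set (X → Y)) (T : ℕ) :
    BddBelow (Set.range fun h : H => hypothesisLoss S h.1 T) :=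
  ⟨0, by rintro _ ⟨h, rfl⟩; exact hypothesisLoss_nonneg S h.1 T⟩

theorem hypothesisLoss_congr {T : ℕ} (hS : ∀ t < T, S t = S' t) (h : X → Y) :
    hypothesisLoss S h T = hypothesisLoss S' h T :=
  Finset.sum_congr rfl fun t ht => by rw [hS t (Finset.mem_range.1 ht)]

/-- Losses are natural numbers, so some hypothesis attains the least loss. -/
theorem exists_hypothesisLoss_eq_iInf (hH : H.Nonempty) (S : ℕ → X × Y) (T : ℕ) :
    ∃ h ∈ H, ⨅ g : H, hypothesisLoss S g.1 T = hypothesisLoss S h T := by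
  classical
  have hnat : ∀ g : X → Y, hypothesisLoss S g T
      = (((Finset.range T).filter fun t => g (S t).1 ≠ (S t).2).card : ℝ) := fun g =>
    Finset.sum_boole _ _
  have : Nonempty H := hH.to_subtype
  let f : H → ℕ := fun g => ((Finset.range T).filter fun t => g.1 (S t).1 ≠ (S t).2).card
  refine ⟨(Function.argmin f).1, (Function.argmin f).2, le_antisymm
    (ciInf_le (bddBelow_hypothesisLoss S H T) _) (le_ciInf fun g => ?_)⟩
  rw [hnat, hnat]
  exact_mod_cast Function.argmin_le f g

namespace BanditLearner

variable (A : BanditLearner.{u, v, w} X Y)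

theorem length_observed (S : ℕ → X × Y) (ω : A.Ω) (t : ℕ) :
    (A.observed S ω t).length = t := by
  induction t with
  | zero => rfl
  | succ t ih => simp [observed, ih]

theorem observed_congr {t : ℕ} (hS : ∀ s < t, S s = S' s) (ω : A.Ω) :
    A.observed S ω t = A.observed S' ω t := by
  induction t with
  | zero => rfl
  | succ t ih =>
    rw [observed, observed, ih fun s hs => hS s (by omega), hS t (by omega)]

theorem prediction_congr {t : ℕ} (hS : ∀ s < t, S s = S' s) (hx : (S t).1 = (S' t).1) (ω : A.Ω) :
    A.prediction S t ω = A.prediction S' t ω := by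
  rw [prediction, prediction, A.observed_congr hS, hx]

theorem mistakeProb_congr {t : ℕ} (hS : ∀ s ≤ t, S s = S' s) :
    A.mistakeProb S t = A.mistakeProb S' t := by
  unfold mistakeProb
  simp only [A.prediction_congr (fun s hs => hS s hs.le) (by rw [hS t le_rfl]), hS t le_rfl]

theorem expectedRegret_le (H : Set (X → Y)) (S : ℕ → X × Y) (T : ℕ) :
    A.expectedRegret H S T ≤ T := by
  rw [expectedRegret_eq]
  have h1 : ∑ t ∈ Finset.range T, A.mistakeProb S t ≤ ∑ t ∈ Finset.range T, (1 : ℝ) :=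
    Finset.sum_le_sum fun t _ => measureReal_le_one
  have h2 : 0 ≤ ⨅ h : H, hypothesisLoss S h.1 T :=
    Real.iInf_nonneg fun h => hypothesisLoss_nonneg S h.1 T
  simp at h1
  linarith

theorem expectedRegret_le_regret (H : Set (X → Y)) (S : ℕ → X × Y) (T : ℕ) :
    A.expectedRegret H S T ≤ A.regret H T :=
  le_ciSup (f := fun S => A.expectedRegret H S T)
    ⟨T, by rintro _ ⟨S, rfl⟩; exact A.expectedRegret_le H S T⟩ S

/-- The regret of every learner is non-decreasing in the horizon: the adversary may continue with
the labels of a currently best hypothesis. -/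
theorem monotone_regret (hH : H.Nonempty) : Monotone (A.regret H) := by
  refine monotone_nat_of_le_succ fun T => ?_
  rcases isEmpty_or_nonempty (ℕ → X × Y) with hE | hE
  · simp [regret]
  refine ciSup_le fun S => ?_
  obtain ⟨h, hh, hmin⟩ := exists_hypothesisLoss_eq_iInf hH S T
  set S' : ℕ → X × Y := fun t => if t < T then S t else ((S t).1, h (S t).1) with hS'
  have hagree : ∀ t < T, S' t = S t := fun t ht => by simp [hS', ht]
  refine le_trans ?_ (A.expectedRegret_le_regret H S' (T + 1))
  rw [expectedRegret_eq, expectedRegret_eq, hmin, Finset.sum_range_succ]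
  have h1 : ∑ t ∈ Finset.range T, A.mistakeProb S' t = ∑ t ∈ Finset.range T, A.mistakeProb S t :=
    Finset.sum_congr rfl fun t ht => A.mistakeProb_congr fun s hs =>
      hagree s (lt_of_le_of_lt hs (Finset.mem_range.1 ht))
  have h2 : ⨅ g : H, hypothesisLoss S' g.1 (T + 1) ≤ hypothesisLoss S h T := by
    refine (ciInf_le (bddBelow_hypothesisLoss S' H (T + 1)) ⟨h, hh⟩).trans (le_of_eq ?_)
    rw [← hypothesisLoss_congr hagree]
    unfold hypothesisLoss
    rw [Finset.sum_range_succ]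
    simp [hS']
  have h3 := A.mistakeProb_nonneg S' T
  linarith

/-- On a stream realized by a hypothesis the expected number of mistakes is at most the regret. -/
theorem sum_mistakeProb_le_regret {h : X → Y} (hh : h ∈ H) {T : ℕ}
    (hS : ∀ t < T, (S t).2 = h (S t).1) :
    ∑ t ∈ Finset.range T, A.mistakeProb S t ≤ A.regret H T := by
  have h0 : hypothesisLoss S h T = 0 := Finset.sum_eq_zero fun t ht => by
    simp [hS t (Finset.mem_range.1 ht)]
  have h1 := ciInf_le (bddBelow_hypothesisLoss S H T) ⟨h, hh⟩
  have h2 := A.expectedRegret_le_regret H S T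
  rw [expectedRegret_eq] at h2
  dsimp only at h1
  linarith

/-! ### Lower bounds -/

theorem measurableSet_prediction_eq (S : ℕ → X × Y) (t : ℕ) (y : Y) :
    MeasurableSet {ω | A.prediction S t ω = y} := by
  have h := (A.measurableSet_mistake (Function.update S t ((S t).1, y)) t).compl
  convert h using 1
  ext ω
  have := A.prediction_congr (S := S) (S' := Function.update S t ((S t).1, y)) (t := t)
    (fun s hs => by rw [Function.update_of_ne hs.ne]) (by simp) ω
  simp [this]

/-- Along a shattered binary tree the adversary, knowing the learner but not its seed, always
picks the less likely of the two labels. -/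
theorem exists_stream_of_littlestoneShatters {d : ℕ} {V : Set (X → Y)}
    (hV : LittlestoneShatters V d) (a : ℕ) (S : ℕ → X × Y) :
    ∃ S' : ℕ → X × Y, (∀ s < a, S' s = S s) ∧ ∃ h ∈ V, ∀ s, a ≤ s → s < a + d →
      (S' s).2 = h (S' s).1 ∧ 1 / 2 ≤ A.mistakeProb S' s := by
  induction d generalizing V a S with
  | zero =>
    obtain ⟨h, hh⟩ := hV
    exact ⟨S, fun _ _ => rfl, h, hh, fun s h1 h2 => by omega⟩
  | succ d ih =>
    obtain ⟨x, y₀, y₁, hne, h₀, h₁⟩ := hV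
    have key : ∃ y, LittlestoneShatters {h ∈ V | h x = y} d ∧
        1 / 2 ≤ A.mistakeProb (Function.update S a (x, y)) a := by
      set P : Y → ℝ := fun y =>
        A.μ.real {ω | A.prediction (Function.update S a (x, y₀)) a ω = y} with hP
      have hpr : ∀ y, A.mistakeProb (Function.update S a (x, y)) a = 1 - P y := by
        intro y
        have hset : {ω | A.prediction (Function.update S a (x, y)) a ω
            ≠ (Function.update S a (x, y) a).2}
            = {ω | A.prediction (Function.update S a (x, y₀)) a ω = y}ᶜ := by
          ext ω
          have := A.prediction_congr (S := Function.update S a (x, y))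
            (S' := Function.update S a (x, y₀)) (t := a)
            (fun s hs => by rw [Function.update_of_ne hs.ne, Function.update_of_ne hs.ne])
            (by simp) ω
          simp [this]
        rw [mistakeProb, hset, probReal_compl_eq_one_sub (A.measurableSet_prediction_eq _ _ _)]
      have hsum : P y₀ + P y₁ ≤ 1 := by
        rw [hP]
        dsimp only
        rw [← measureReal_union _ (A.measurableSet_prediction_eq _ _ _)]
        · exact measureReal_le_one
        · rw [Set.disjoint_left]
          intro ω h1 h2
          exact hne (h1.symm.trans h2)
      by_cases hle : P y₀ ≤ 1 / 2
      · exact ⟨y₀, h₀, by rw [hpr]; linarith⟩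
      · exact ⟨y₁, h₁, by rw [hpr]; linarith⟩
    obtain ⟨y, hy, hhalf⟩ := key
    obtain ⟨S', hS', h, hh, hrest⟩ := ih hy (a + 1) (Function.update S a (x, y))
    refine ⟨S', fun s hs => ?_, h, hh.1, fun s h1 h2 => ?_⟩
    · rw [hS' s (by omega), Function.update_of_ne hs.ne]
    · rcases h1.eq_or_lt with rfl | hlt
      · constructor
        · rw [hS' a (by omega)]
          simpa using hh.2.symm
        · rwa [A.mistakeProb_congr (S' := Function.update S a (x, y)) fun s hs =>
            hS' s (by omega)]
      · exact hrest s hlt (by omega)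

theorem half_le_regret_of_littlestoneShatters {T : ℕ} (hT : T ≠ 0)
    (hH : LittlestoneShatters H T) : (T : ℝ) / 2 ≤ A.regret H T := by
  have hxy : Nonempty (X × Y) := by
    obtain ⟨T, rfl⟩ := Nat.exists_eq_succ_of_ne_zero hT
    obtain ⟨x, y, -⟩ := hH
    exact ⟨(x, y)⟩
  obtain ⟨S, -, h, hh, hS⟩ :=
    A.exists_stream_of_littlestoneShatters hH 0 (fun _ => Classical.arbitrary _)
  refine le_trans ?_ (A.sum_mistakeProb_le_regret (S := S) hh fun t ht => (hS t (by omega)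
    (by omega)).1)
  calc (T : ℝ) / 2 = ∑ t ∈ Finset.range T, (1 / 2 : ℝ) := by simp; ring
    _ ≤ _ := Finset.sum_le_sum fun t ht =>
      (hS t (by omega) (by simpa using ht)).2

/-- If the first `T` predictions on an instance with at least `2 * T` labels are all told to be
wrong, most of these labels are unlikely to have been tried. -/
theorem half_le_regret_of_labels {T : ℕ} (x : X) (F : Finset Y) (hF : 2 * T ≤ F.card)
    (hFne : F.Nonempty) (hFH : ∀ y ∈ F, ∃ h ∈ H, h x = y) : (T : ℝ) / 2 ≤ A.regret H T := by
  classical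
  set past : ℕ → List (X × Bool) := fun t => List.replicate t (x, true) with hpast
  set E : ℕ → Y → Set A.Ω := fun t y => {ω | A.predict ω (past t) x = y} with hE
  have hEm : ∀ t y, MeasurableSet (E t y) := fun t y => A.measurableSet_predict _ _ _
  have hrow : ∀ t, ∑ y ∈ F, A.μ.real (E t y) ≤ 1 := by
    intro t
    rw [← measureReal_biUnion_finset (fun y _ z _ hyz => ?_) fun y _ => hEm t y]
    · exact measureReal_le_one
    · exact Set.disjoint_left.2 fun ω h1 h2 => hyz (h1.symm.trans h2)
  have hex : ∃ y ∈ F, ∑ t ∈ Finset.range T, A.μ.real (E t y) ≤ 1 / 2 := by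
    refine Finset.exists_le_of_sum_le (g := fun _ => (1 / 2 : ℝ)) hFne ?_
    rw [Finset.sum_comm]
    calc ∑ t ∈ Finset.range T, ∑ y ∈ F, A.μ.real (E t y) ≤ ∑ t ∈ Finset.range T, (1 : ℝ) :=
          Finset.sum_le_sum fun t _ => hrow t
      _ ≤ ∑ y ∈ F, (1 / 2 : ℝ) := by
          have : (2 * T : ℝ) ≤ F.card := by exact_mod_cast hF
          simp
          linarith
  obtain ⟨y, hyF, hy⟩ := hex
  obtain ⟨h, hh, hxy⟩ := hFH y hyF
  refine le_trans ?_ (A.sum_mistakeProb_le_regret (S := fun _ => (x, y)) hh fun t _ => hxy.symm)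
  have hbad : ∀ ω, ω ∉ ⋃ t ∈ Finset.range T, E t y →
      ∀ t ≤ T, A.observed (fun _ => (x, y)) ω t = past t := by
    intro ω hω t
    induction t with
    | zero => intro _; rfl
    | succ t ih =>
      intro ht
      have hne : A.predict ω (past t) x ≠ y := fun heq => hω (by
        simp only [Set.mem_iUnion]
        exact ⟨t, Finset.mem_range.2 (by omega), heq⟩)
      rw [observed, ih (by omega)]
      rw [decide_eq_true hne]
      exact List.replicate_succ'.symm
  have hunion : A.μ.real (⋃ t ∈ Finset.range T, E t y) ≤ 1 / 2 :=
    (measureReal_biUnion_finset_le _ _).trans hy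
  calc (T : ℝ) / 2 = ∑ t ∈ Finset.range T, (1 / 2 : ℝ) := by simp; ring
    _ ≤ _ := Finset.sum_le_sum fun t ht => ?_
  have ht' := Finset.mem_range.1 ht
  have hm : MeasurableSet (⋃ t ∈ Finset.range T, E t y) :=
    Finset.measurableSet_biUnion _ fun t _ => hEm t y
  have hsub : (⋃ t ∈ Finset.range T, E t y)ᶜ
      ⊆ {ω | A.prediction (fun _ => (x, y)) t ω ≠ y} := by
    intro ω hω heq
    refine hω ?_
    simp only [Set.mem_iUnion]
    refine ⟨t, ht, ?_⟩
    rwa [prediction, hbad ω hω t ht'.le] at heq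
  have := measureReal_mono (μ := A.μ) hsub
  rw [probReal_compl_eq_one_sub hm] at this
  unfold mistakeProb
  dsimp only
  linarith

end BanditLearner

/-- Sublinear regret bounds the number of labels and the Littlestone dimension, hence the bandit
Littlestone dimension. -/
theorem exists_not_shattersDepth_of_learnable (hH : H.Nonempty)
    (h : BanditOnlineLearnable.{u, v, w} H) : ∃ D, ¬ ShattersDepth H D := by
  obtain ⟨A, -, hA⟩ := h
  rcases isEmpty_or_nonempty X with hX | ⟨⟨x₀⟩⟩
  · exact ⟨1, fun ⟨x, _⟩ => hX.elim x⟩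
  have hY : Nonempty Y := ⟨hH.some x₀⟩
  obtain ⟨T, hT1, hT⟩ : ∃ T : ℕ, 1 ≤ T ∧ A.regret H T < (T : ℝ) / 2 := by
    have := (hA.bound (show (0 : ℝ) < 1 / 4 by norm_num)).and (eventually_ge_atTop 1)
    obtain ⟨T, hT, hT1⟩ := this.exists
    refine ⟨T, hT1, lt_of_le_of_lt (le_abs_self _) ?_⟩
    have hT1' : (1 : ℝ) ≤ T := by exact_mod_cast hT1
    simp only [Real.norm_eq_abs, Nat.abs_cast] at hT
    linarith
  refine exists_not_shattersDepth (K := 2 * T) (ℓ := T) (by omega) (fun x => ?_) fun hL =>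
    absurd (A.half_le_regret_of_littlestoneShatters (by omega) hL) (not_le.2 hT)
  by_contra! hlt
  obtain ⟨F', hF', hcard⟩ := Set.exists_subset_encard_eq hlt.le
  have hfin : F'.Finite := Set.finite_of_encard_eq_coe hcard
  refine absurd (A.half_le_regret_of_labels x hfin.toFinset (T := T) (H := H) ?_ ?_ ?_)
    (not_le.2 hT)
  · rw [hfin.encard_eq_coe_toFinset_card] at hcard
    exact (by exact_mod_cast hcard.ge : 2 * T ≤ _)
  · rw [hfin.encard_eq_coe_toFinset_card] at hcard
    have : hfin.toFinset.card = 2 * T := by exact_mod_cast hcard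
    exact Finset.card_pos.1 (by omega)
  · intro y hy
    obtain ⟨h, hh, rfl⟩ := hF' (hfin.mem_toFinset.1 hy)
    exact ⟨h, hh, rfl⟩

end Regret

/-! ### Learners that draw an index from a law depending on a state -/

/-- The seed of a single round: a uniform point of the unit interval, lifted to any universe. -/
abbrev RoundSeed : Type w := ULift.{w} unitInterval

/-- The uniform law on `RoundSeed`. -/
noncomputable def roundSeedLaw : Measure RoundSeed.{w} :=
  (volume : Measure unitInterval).map ULift.up

instance : IsProbabilityMeasure roundSeedLaw.{w} :=
  Measure.isProbabilityMeasure_map measurable_up.aemeasurable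

theorem exists_sampler {K : ℕ} (p : stdSimplex ℝ (Fin K)) :
    ∃ f : RoundSeed.{w} → Fin K, Measurable f ∧
      ∀ a, roundSeedLaw.real (f ⁻¹' {a}) = p.1 a := by
  classical
  set μ : Measure (Fin K) := ∑ a, ENNReal.ofReal (p.1 a) • Measure.dirac a with hμ
  have hμs : ∀ a, μ {a} = ENNReal.ofReal (p.1 a) := by
    intro a
    rw [hμ, Measure.finsetSum_apply, Finset.sum_eq_single a]
    · simp
    · intro b _ hb
      simp [hb]
    · simp
  have hprob : IsProbabilityMeasure μ := by
    constructor
    rw [hμ, Measure.finsetSum_apply]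
    simp only [Measure.smul_apply, measure_univ, smul_eq_mul, mul_one]
    rw [← ENNReal.ofReal_sum_of_nonneg fun a _ => p.2.1 a, p.2.2, ENNReal.ofReal_one]
  have : Nonempty (Fin K) := by
    by_contra hE
    rw [not_nonempty_iff] at hE
    have := p.2.2
    simp at this
  obtain ⟨f, hf, hfμ⟩ := μ.exists_measurable_map_eq
  refine ⟨fun u => f u.down, hf.comp measurable_down, fun a => ?_⟩
  have hm : MeasurableSet ((fun u : RoundSeed.{w} => f u.down) ⁻¹' {a}) :=
    hf.comp measurable_down (measurableSet_singleton a)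
  rw [measureReal_def, roundSeedLaw, Measure.map_apply measurable_up hm]
  have : ULift.up ⁻¹' ((fun u : RoundSeed.{w} => f u.down) ⁻¹' {a}) = f ⁻¹' {a} := rfl
  rw [this, ← Measure.map_apply hf (measurableSet_singleton a), hfμ, hμs,
    ENNReal.toReal_ofReal (p.2.1 a)]

/-- A function of the round seed with law `p`. -/
noncomputable def sampler {K : ℕ} (p : stdSimplex ℝ (Fin K)) : RoundSeed.{w} → Fin K :=
  (exists_sampler p).choose

theorem measurable_sampler {K : ℕ} (p : stdSimplex ℝ (Fin K)) : Measurable (sampler.{w} p) :=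
  (exists_sampler p).choose_spec.1

theorem roundSeedLaw_sampler {K : ℕ} (p : stdSimplex ℝ (Fin K)) (a : Fin K) :
    roundSeedLaw.real (sampler.{w} p ⁻¹' {a}) = p.1 a :=
  (exists_sampler p).choose_spec.2 a

/-- The law of independent round seeds. -/
noncomputable def seedLaw : Measure (ℕ → RoundSeed.{w}) := Measure.infinitePi fun _ => roundSeedLaw

instance : IsProbabilityMeasure seedLaw.{w} := by unfold seedLaw; infer_instance

/-- The information contained in the seeds of the first `t` rounds. -/
abbrev seedFiltration (t : ℕ) : MeasurableSpace (ℕ → RoundSeed.{w}) :=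
  ⨆ i ∈ Set.Iio t, MeasurableSpace.comap (fun ω => ω i) inferInstance

theorem seedFiltration_le (t : ℕ) : seedFiltration.{w} t ≤ MeasurableSpace.pi :=
  iSup₂_le fun i _ => (measurable_pi_apply i).comap_le

theorem seedFiltration_mono : Monotone seedFiltration.{w} := fun _ _ hst =>
  biSup_mono fun _ hi => lt_of_lt_of_le hi hst

theorem measurable_seedFiltration_succ (t : ℕ) :
    Measurable[seedFiltration.{w} (t + 1)] fun ω : ℕ → RoundSeed.{w} => ω t := by
  refine Measurable.mono (comap_measurable _) ?_ le_rfl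
  exact le_iSup₂_of_le (f := fun i (_ : i ∈ Set.Iio (t + 1)) =>
    MeasurableSpace.comap (fun ω : ℕ → RoundSeed.{w} => ω i) inferInstance) t
    (Nat.lt_succ_self t) le_rfl

/-- The seed of round `t` is independent of the earlier ones. -/
theorem seedLaw_inter {t : ℕ} {s : Set (ℕ → RoundSeed.{w})} (hs : MeasurableSet[seedFiltration t] s)
    {B : Set RoundSeed.{w}} (hB : MeasurableSet B) :
    seedLaw.real (s ∩ (fun ω => ω t) ⁻¹' B) = seedLaw.real s * roundSeedLaw.real B := by
  have hind : ProbabilityTheory.iIndepFun (fun i (ω : ℕ → RoundSeed.{w}) => ω i) seedLaw :=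
    ProbabilityTheory.iIndepFun_infinitePi (X := fun _ => id) fun _ => measurable_id
  have h := ProbabilityTheory.indep_iSup_of_disjoint
    (fun i => (measurable_pi_apply i).comap_le) hind.iIndep
    (S := Set.Iio t) (T := {t}) (by simp)
  have hB' : MeasurableSet[⨆ i ∈ ({t} : Set ℕ), MeasurableSpace.comap
      (fun ω : ℕ → RoundSeed.{w} => ω i) inferInstance] ((fun ω => ω t) ⁻¹' B) := by
    rw [iSup_singleton]
    exact ⟨B, hB, rfl⟩
  have := (ProbabilityTheory.Indep_iff _ _ _).1 h _ _ hs hB'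
  rw [measureReal_def, this, ENNReal.toReal_mul]
  congr 1
  rw [← measureReal_def]
  have hmap : seedLaw.map (fun ω => ω t) = roundSeedLaw.{w} := Measure.infinitePi_map_eval _ t
  rw [← hmap, map_measureReal_apply (measurable_pi_apply t) hB]

/-- Conditioning on a simple function: if, given `f = s`, the index `g s` has law `p s`, then
expectations may be averaged over that law. -/
theorem integral_eq_integral_sum {Ω σ : Type*} [m : MeasurableSpace Ω] (μ : Measure Ω)
    [IsProbabilityMeasure μ] {K : ℕ} {f : Ω → σ} (hf : IsSimple m f) {g : σ → Ω → Fin K}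
    (hg : ∀ s, Measurable (g s)) (p : σ → Fin K → ℝ)
    (hp : ∀ s a, μ.real (f ⁻¹' {s} ∩ g s ⁻¹' {a}) = μ.real (f ⁻¹' {s}) * p s a)
    (F : σ → Fin K → ℝ) :
    ∫ ω, F (f ω) (g (f ω) ω) ∂μ = ∫ ω, ∑ a, p (f ω) a * F (f ω) a ∂μ := by
  classical
  set R := hf.1.toFinset with hR
  have hmem : ∀ ω, f ω ∈ R := fun ω => hf.1.mem_toFinset.2 ⟨ω, rfl⟩
  have hmeas : ∀ s a, MeasurableSet (f ⁻¹' {s} ∩ g s ⁻¹' {a}) := fun s a =>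
    (hf.2 s).inter (hg s (measurableSet_singleton a))
  have h1 : ∀ ω, F (f ω) (g (f ω) ω)
      = ∑ s ∈ R, ∑ a, (f ⁻¹' {s} ∩ g s ⁻¹' {a}).indicator (fun _ => F s a) ω := by
    intro ω
    rw [Finset.sum_eq_single (f ω), Finset.sum_eq_single (g (f ω) ω)]
    · simp
    · intro a _ ha
      simp [Ne.symm ha]
    · simp
    · intro s _ hs
      simp [Ne.symm hs]
    · exact fun h => absurd (hmem ω) h
  have h2 : ∀ ω, ∑ a, p (f ω) a * F (f ω) a
      = ∑ s ∈ R, (f ⁻¹' {s}).indicator (fun _ => ∑ a, p s a * F s a) ω := by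
    intro ω
    rw [Finset.sum_eq_single (f ω)]
    · simp
    · intro s _ hs
      simp [Ne.symm hs]
    · exact fun h => absurd (hmem ω) h
  simp_rw [h1, h2]
  rw [integral_finsetSum _ fun s _ => integrable_finsetSum _ fun a _ =>
      (integrable_const _).indicator (hmeas s a),
    integral_finsetSum _ fun s _ => (integrable_const _).indicator (hf.2 s)]
  refine Finset.sum_congr rfl fun s _ => ?_
  rw [integral_finsetSum _ fun a _ => (integrable_const _).indicator (hmeas s a),
    integral_indicator_const _ (hf.2 s), smul_eq_mul, Finset.mul_sum]
  refine Finset.sum_congr rfl fun a _ => ?_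
  rw [integral_indicator_const _ (hmeas s a), hp, smul_eq_mul, mul_assoc]

/-- An algorithm with a state: in round `t` it draws an index from a law depending on its state
and the instance, predicts the label with this index, and updates its state by means of the drawn
index and the feedback. -/
structure StateAlgorithm (X : Type u) (Y : Type v) (K : ℕ) (σ : Type*) where
  /-- the state before the first round -/
  init : σ
  /-- the new state, given the round, state, instance, drawn index and feedback -/
  step : ℕ → σ → X → Fin K → Bool → σ
  /-- the law of the index, given the round, state and instance -/
  law : ℕ → σ → X → stdSimplex ℝ (Fin K)
  /-- the label with a given index -/
  label : X → Fin K → Y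

namespace StateAlgorithm

variable {X : Type u} {Y : Type v} {K : ℕ} {σ : Type*} (𝔄 : StateAlgorithm X Y K σ)

/-- The index drawn in round `t`. -/
noncomputable def draw (ω : ℕ → RoundSeed.{w}) (t : ℕ) (s : σ) (x : X) : Fin K :=
  sampler (𝔄.law t s x) (ω t)

/-- The state after a given past; the list has the most recent round first. -/
noncomputable def stateAfter (ω : ℕ → RoundSeed.{w}) : List (X × Bool) → σ
  | [] => 𝔄.init
  | q :: l => 𝔄.step l.length (stateAfter ω l) q.1
      (𝔄.draw ω l.length (stateAfter ω l) q.1) q.2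

theorem isSimple_draw (t : ℕ) (s : σ) (x : X) :
    IsSimple (seedFiltration.{w} (t + 1)) (fun ω => 𝔄.draw ω t s x) :=
  IsSimple.of_measurable ((measurable_sampler _).comp (measurable_seedFiltration_succ t))

theorem isSimple_stateAfter (l : List (X × Bool)) :
    IsSimple (seedFiltration.{w} l.length) (fun ω => 𝔄.stateAfter ω l) := by
  induction l with
  | nil => exact IsSimple.const _ _
  | cons q l ih =>
    refine (ih.mono (seedFiltration_mono (Nat.le_succ _))).bind
      (g := fun s ω => 𝔄.step l.length s q.1 (𝔄.draw ω l.length s q.1) q.2) fun s => ?_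
    exact (𝔄.isSimple_draw l.length s q.1).comp fun a => 𝔄.step l.length s q.1 a q.2

/-- The bandit learner that runs a state algorithm with independent round seeds. -/
noncomputable def toLearner : BanditLearner.{u, v, w} X Y where
  Ω := ℕ → RoundSeed.{w}
  mΩ := MeasurableSpace.pi
  μ := seedLaw
  isProb := inferInstance
  predict ω past x := 𝔄.label x (𝔄.draw ω past.length (𝔄.stateAfter ω past.reverse) x)
  measurableSet_predict past x y := by
    have h := ((𝔄.isSimple_stateAfter past.reverse).mono (seedFiltration_le _)).bind
      (g := fun s ω => 𝔄.label x (𝔄.draw ω past.length s x)) fun s =>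
        ((𝔄.isSimple_draw past.length s x).mono (seedFiltration_le _)).comp _
    exact h.2 y

/-- The state before round `t` when the algorithm plays against `S`. -/
noncomputable def playState (S : ℕ → X × Y) (t : ℕ) (ω : ℕ → RoundSeed.{w}) : σ :=
  𝔄.stateAfter ω ((𝔄.toLearner : BanditLearner.{u, v, w} X Y).observed S ω t).reverse

theorem prediction_toLearner (S : ℕ → X × Y) (t : ℕ) (ω : ℕ → RoundSeed.{w}) :
    (𝔄.toLearner : BanditLearner.{u, v, w} X Y).prediction S t ω
      = 𝔄.label (S t).1 (𝔄.draw ω t (𝔄.playState S t ω) (S t).1) := by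
  change 𝔄.label (S t).1 (𝔄.draw ω
    ((𝔄.toLearner : BanditLearner.{u, v, w} X Y).observed S ω t).length
    (𝔄.playState S t ω) (S t).1) = _
  rw [(𝔄.toLearner : BanditLearner.{u, v, w} X Y).length_observed S ω t]

open Classical in
theorem playState_succ (S : ℕ → X × Y) (t : ℕ) (ω : ℕ → RoundSeed.{w}) :
    𝔄.playState S (t + 1) ω = 𝔄.step t (𝔄.playState S t ω) (S t).1
      (𝔄.draw ω t (𝔄.playState S t ω) (S t).1)
      (decide (𝔄.label (S t).1 (𝔄.draw ω t (𝔄.playState S t ω) (S t).1) ≠ (S t).2)) := by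
  have hp := 𝔄.prediction_toLearner S t ω
  have ho : (𝔄.toLearner : BanditLearner.{u, v, w} X Y).observed S ω (t + 1)
      = (𝔄.toLearner : BanditLearner.{u, v, w} X Y).observed S ω t ++ [((S t).1,
        decide ((𝔄.toLearner : BanditLearner.{u, v, w} X Y).prediction S t ω ≠ (S t).2))] := rfl
  rw [playState, ho, List.reverse_append]
  change 𝔄.step ((𝔄.toLearner : BanditLearner.{u, v, w} X Y).observed S ω t).reverse.length
    (𝔄.playState S t ω) (S t).1
    (𝔄.draw ω ((𝔄.toLearner : BanditLearner.{u, v, w} X Y).observed S ω t).reverse.length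
      (𝔄.playState S t ω) (S t).1)
    (decide ((𝔄.toLearner : BanditLearner.{u, v, w} X Y).prediction S t ω ≠ (S t).2)) = _
  rw [hp, List.length_reverse,
    (𝔄.toLearner : BanditLearner.{u, v, w} X Y).length_observed S ω t]

theorem isSimple_playState (S : ℕ → X × Y) (t : ℕ) :
    IsSimple (seedFiltration.{w} t) (𝔄.playState S t) := by
  classical
  induction t with
  | zero => exact IsSimple.const _ _
  | succ t ih =>
    simp_rw [funext (𝔄.playState_succ S t)]
    refine (ih.mono (seedFiltration_mono (Nat.le_succ _))).bind
      (g := fun s ω => 𝔄.step t s (S t).1 (𝔄.draw ω t s (S t).1)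
        (decide (𝔄.label (S t).1 (𝔄.draw ω t s (S t).1) ≠ (S t).2))) fun s => ?_
    exact (𝔄.isSimple_draw t s (S t).1).comp fun a => 𝔄.step t s (S t).1 a
      (decide (𝔄.label (S t).1 a ≠ (S t).2))

theorem integrable_playState (S : ℕ → X × Y) (t : ℕ) (F : σ → ℝ) :
    Integrable (fun ω => F (𝔄.playState S t ω)) seedLaw.{w} :=
  (((𝔄.isSimple_playState S t).mono (seedFiltration_le t)).comp F).integrable _

theorem integrable_playState_draw (S : ℕ → X × Y) (t : ℕ) (F : σ → Fin K → ℝ) :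
    Integrable (fun ω => F (𝔄.playState S t ω) (𝔄.draw ω t (𝔄.playState S t ω) (S t).1))
      seedLaw.{w} := by
  refine IsSimple.integrable (m := inferInstance) ?_ _
  exact ((𝔄.isSimple_playState S t).mono (seedFiltration_le t)).bind
    (g := fun s ω => F s (𝔄.draw ω t s (S t).1)) fun s =>
      ((𝔄.isSimple_draw t s (S t).1).mono (seedFiltration_le _)).comp (F s)

/-- In each round the index may be averaged over its law given the state. -/
theorem integral_playState_draw (S : ℕ → X × Y) (t : ℕ) (F : σ → Fin K → ℝ) :
    ∫ ω, F (𝔄.playState S t ω) (𝔄.draw ω t (𝔄.playState S t ω) (S t).1) ∂seedLaw.{w}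
      = ∫ ω, ∑ a, (𝔄.law t (𝔄.playState S t ω) (S t).1).1 a * F (𝔄.playState S t ω) a
          ∂seedLaw.{w} := by
  refine integral_eq_integral_sum seedLaw
    ((𝔄.isSimple_playState S t).mono (seedFiltration_le t))
    (g := fun s ω => 𝔄.draw ω t s (S t).1)
    (fun s => (measurable_sampler _).comp (measurable_pi_apply t))
    (fun s a => (𝔄.law t s (S t).1).1 a) (fun s a => ?_) F
  rw [← roundSeedLaw_sampler.{w} (𝔄.law t s (S t).1) a]
  exact seedLaw_inter ((𝔄.isSimple_playState S t).2 s)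
    (measurable_sampler _ (measurableSet_singleton a))

open Classical in
theorem mistakeProb_toLearner (S : ℕ → X × Y) (t : ℕ) :
    (𝔄.toLearner : BanditLearner.{u, v, w} X Y).mistakeProb S t
      = ∫ ω, (if 𝔄.label (S t).1 (𝔄.draw ω t (𝔄.playState S t ω) (S t).1) ≠ (S t).2
          then (1 : ℝ) else 0) ∂seedLaw.{w} := by
  rw [BanditLearner.mistakeProb_eq_integral]
  simp_rw [← prediction_toLearner]
  rfl

end StateAlgorithm

/-! ### One round of exponential weights with importance-weighted losses -/

section ExponentialWeights

variable {ι : Type*} {K : ℕ}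

open Classical in
/-- The share of the weights `exp (L e)`, `e ∈ E`, held by the experts that advise `a`. -/
noncomputable def adviceShare (E : Finset ι) (L : ι → ℝ) (adv : ι → Fin K) (a : Fin K) : ℝ :=
  (∑ e ∈ E with adv e = a, Real.exp (L e)) / ∑ e ∈ E, Real.exp (L e)

theorem sum_exp_pos {E : Finset ι} (hE : E.Nonempty) (L : ι → ℝ) :
    0 < ∑ e ∈ E, Real.exp (L e) :=
  Finset.sum_pos (fun _ _ => Real.exp_pos _) hE

theorem adviceShare_mem_stdSimplex {E : Finset ι} (hE : E.Nonempty) (L : ι → ℝ)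
    (adv : ι → Fin K) : adviceShare E L adv ∈ stdSimplex ℝ (Fin K) := by
  constructor
  · intro a
    exact div_nonneg (Finset.sum_nonneg fun _ _ => (Real.exp_pos _).le) (sum_exp_pos hE L).le
  · unfold adviceShare
    rw [← Finset.sum_div, Finset.sum_fiberwise, div_self (sum_exp_pos hE L).ne']

open Classical in
/-- The log-weights after a mistake with the index `a`: the experts advising `a` are charged the
importance-weighted loss. -/
noncomputable def chargeAdvice (η : ℝ) (E : Finset ι) (L : ι → ℝ) (adv : ι → Fin K) (a : Fin K)
    (e : ι) : ℝ :=
  if adv e = a then L e - η / adviceShare E L adv a else L e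

/-- The potential of the expert `e`: the scaled logarithm of the inverse of its share. -/
noncomputable def hedgePotential (η : ℝ) (E : Finset ι) (L : ι → ℝ) (e : ι) : ℝ :=
  (Real.log (∑ i ∈ E, Real.exp (L i)) - L e) / η

theorem hedgePotential_nonneg {η : ℝ} (hη : 0 < η) {E : Finset ι} (L : ι → ℝ) {e : ι}
    (he : e ∈ E) : 0 ≤ hedgePotential η E L e := by
  refine div_nonneg (sub_nonneg.2 ?_) hη.le
  rw [Real.le_log_iff_exp_le (sum_exp_pos ⟨e, he⟩ L)]
  exact Finset.single_le_sum (f := fun i => Real.exp (L i)) (fun _ _ => (Real.exp_pos _).le) he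

theorem exp_neg_le_one_sub_add_sq {x : ℝ} (hx : 0 ≤ x) : Real.exp (-x) ≤ 1 - x + x ^ 2 := by
  rw [Real.exp_neg]
  refine (inv_anti₀ (by linarith) (Real.add_one_le_exp x)).trans ?_
  rw [inv_le_iff_one_le_mul₀ (by linarith)]
  nlinarith [pow_nonneg hx 3]

/-- Effect of a charge on the logarithm of the total weight. -/
theorem log_sum_exp_chargeAdvice_le {η : ℝ} (hη : 0 < η) {E : Finset ι} (hE : E.Nonempty)
    (L : ι → ℝ) (adv : ι → Fin K) {a : Fin K} (ha : 0 < adviceShare E L adv a) :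
    Real.log (∑ e ∈ E, Real.exp (chargeAdvice η E L adv a e))
      ≤ Real.log (∑ e ∈ E, Real.exp (L e)) - η + η ^ 2 / adviceShare E L adv a := by
  classical
  set p := adviceShare E L adv a with hp
  set W := ∑ e ∈ E, Real.exp (L e) with hW
  have hWpos : 0 < W := sum_exp_pos hE L
  have hpW : ∑ e ∈ E with adv e = a, Real.exp (L e) = p * W := by
    rw [hp, adviceShare, div_mul_cancel₀ _ hWpos.ne']
  have hW' : ∑ e ∈ E, Real.exp (chargeAdvice η E L adv a e)
      = W * (1 - p * (1 - Real.exp (-(η / p)))) := by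
    have h1 : ∀ e ∈ E, Real.exp (chargeAdvice η E L adv a e)
        = Real.exp (L e) - if adv e = a then Real.exp (L e) * (1 - Real.exp (-(η / p))) else 0 := by
      intro e _
      unfold chargeAdvice
      split_ifs
      · rw [sub_eq_add_neg, Real.exp_add]; ring
      · ring
    rw [Finset.sum_congr rfl h1, Finset.sum_sub_distrib, ← Finset.sum_filter, ← Finset.sum_mul,
      hpW]
    ring
  have hpos : 0 < ∑ e ∈ E, Real.exp (chargeAdvice η E L adv a e) := sum_exp_pos hE _
  have hfac : 0 < 1 - p * (1 - Real.exp (-(η / p))) := by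
    rw [hW'] at hpos
    exact pos_of_mul_pos_right hpos hWpos.le
  rw [hW', Real.log_mul hWpos.ne' hfac.ne']
  have h2 := Real.log_le_sub_one_of_pos hfac
  have h3 := exp_neg_le_one_sub_add_sq (div_nonneg hη.le ha.le)
  have h4 : p * (1 - Real.exp (-(η / p))) ≥ p * (η / p - (η / p) ^ 2) :=
    mul_le_mul_of_nonneg_left (by linarith) ha.le
  have h5 : p * (η / p - (η / p) ^ 2) = η - η ^ 2 / p := by
    field_simp
  linarith

/-- One round of exponential weights: the expected mistake plus the expected new potential is at
most the mistake of the expert plus its old potential plus `η K`. -/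
theorem sum_adviceShare_mul_le {η : ℝ} (hη : 0 < η) {E : Finset ι} (L : ι → ℝ)
    (adv : ι → Fin K) {e : ι} (he : e ∈ E) (c : Fin K → Prop) [DecidablePred c] :
    ∑ a, adviceShare E L adv a * ((if c a then 1 else 0)
        + hedgePotential η E (if c a then chargeAdvice η E L adv a else L) e)
      ≤ (if c (adv e) then 1 else 0) + hedgePotential η E L e + η * K := by
  have hE : E.Nonempty := ⟨e, he⟩
  set Φ := hedgePotential η E L e with hΦ
  have hsimp := adviceShare_mem_stdSimplex hE L adv
  have hterm : ∀ a, adviceShare E L adv a * ((if c a then 1 else 0)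
        + hedgePotential η E (if c a then chargeAdvice η E L adv a else L) e)
      ≤ adviceShare E L adv a * Φ
        + (η + if a = adv e then (if c (adv e) then 1 else 0) else 0) := by
    intro a
    by_cases hca : c a
    swap
    · simp only [hca, if_false, zero_add, ← hΦ]
      have : 0 ≤ (if a = adv e then (if c (adv e) then (1 : ℝ) else 0) else 0) := by
        split_ifs <;> norm_num
      linarith
    rcases (hsimp.1 a).eq_or_lt with h0 | hpos
    · rw [← h0]
      have : 0 ≤ (if a = adv e then (if c (adv e) then (1 : ℝ) else 0) else 0) := by
        split_ifs <;> norm_num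
      linarith
    -- A mistake costs `1`, lowers the logarithm of the total weight by `η` up to second order, and
    -- charges the expert `η / p` if it advised `a`; multiplied by `p`, the terms of order `1` leave
    -- exactly the mistake of the expert, and the second-order term is `η`.
    simp only [hca, if_true]
    set p := adviceShare E L adv a with hp
    have hlog := log_sum_exp_chargeAdvice_le hη hE L adv hpos
    rw [← hp] at hlog
    have hpot : hedgePotential η E (chargeAdvice η E L adv a) e
        ≤ Φ - 1 + η / p + if a = adv e then 1 / p else 0 := by
      rw [hΦ, hedgePotential, hedgePotential, div_le_iff₀ hη]
      have hR : ((Real.log (∑ i ∈ E, Real.exp (L i)) - L e) / η - 1 + η / p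
          + if a = adv e then 1 / p else 0) * η
          = Real.log (∑ i ∈ E, Real.exp (L i)) - L e - η + η ^ 2 / p
            + if a = adv e then η / p else 0 := by
        split_ifs
        · field_simp
        · field_simp
          ring
      rw [hR]
      by_cases hae : a = adv e
      · rw [if_pos hae, chargeAdvice, if_pos hae.symm, ← hp]
        linarith
      · rw [if_neg hae, chargeAdvice, if_neg (Ne.symm hae)]
        linarith
    have hmul : p * (1 + hedgePotential η E (chargeAdvice η E L adv a) e)
        ≤ p * (1 + (Φ - 1 + η / p + if a = adv e then 1 / p else 0)) :=
      mul_le_mul_of_nonneg_left (by linarith) hpos.le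
    refine hmul.trans (le_of_eq ?_)
    by_cases hae : a = adv e
    · rw [if_pos hae, if_pos hae, ← hae, if_pos hca]
      field_simp
      ring
    · rw [if_neg hae, if_neg hae]
      field_simp
      ring
  refine (Finset.sum_le_sum fun a _ => hterm a).trans (le_of_eq ?_)
  rw [Finset.sum_add_distrib, ← Finset.sum_mul, hsimp.2, Finset.sum_add_distrib]
  simp
  ring

end ExponentialWeights

/-! ### The bandit standard optimal algorithm -/

section StandardOptimalAlgorithm

variable {X : Type u} {Y : Type v}

/-- A list of at most `K` elements can be indexed by `Fin K`, filling up with a default. -/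
theorem exists_enumeration {α : Type*} {K : ℕ} (F : Finset α) (hF : F.card ≤ K) (z : α) :
    ∃ e : Fin K → α, (∀ a ∈ F, ∃ i, e i = a) ∧ ∀ i, e i = z ∨ e i ∈ F := by
  refine ⟨fun i => if h : (i : ℕ) < F.card then (F.equivFin.symm ⟨i, h⟩ : α) else z, ?_, ?_⟩
  · intro a ha
    refine ⟨⟨F.equivFin ⟨a, ha⟩, (F.equivFin ⟨a, ha⟩).2.trans_le hF⟩, ?_⟩
    simp
  · intro i
    dsimp only
    split_ifs with h
    · exact Or.inr (F.equivFin.symm ⟨i, h⟩).2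
    · exact Or.inl rfl

/-- The label predicted by the bandit standard optimal algorithm: ruling it out decreases the
bound `p.2` on the shattering depth of the version space `p.1`, if possible. -/
noncomputable def soaLabel [Nonempty Y] (p : Set (X → Y) × ℕ) (x : X) : Y :=
  Classical.epsilon fun y => ¬ ShattersDepth {h ∈ p.1 | h x ≠ y} (p.2 - 1)

/-- The version space and depth bound after the predicted label has turned out to be wrong. -/
noncomputable def soaUpdate [Nonempty Y] (p : Set (X → Y) × ℕ) (x : X) : Set (X → Y) × ℕ :=
  ({h ∈ p.1 | h x ≠ soaLabel p x}, p.2 - 1)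

theorem not_shattersDepth_soaUpdate [Nonempty Y] {p : Set (X → Y) × ℕ} {h : X → Y}
    (hp : ¬ ShattersDepth p.1 p.2) (hh : h ∈ p.1) (x : X) :
    (soaUpdate p x).2 + 1 = p.2 ∧ ¬ ShattersDepth (soaUpdate p x).1 (soaUpdate p x).2 := by
  obtain ⟨V, m⟩ := p
  cases m with
  | zero => exact absurd ⟨h, hh⟩ hp
  | succ m =>
    refine ⟨rfl, ?_⟩
    have : ∃ y, ¬ ShattersDepth {h ∈ V | h x ≠ y} m := by
      by_contra! hall
      exact hp ⟨x, hall⟩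
    exact Classical.epsilon_spec this

open Classical in
/-- The run of the standard optimal algorithm from `(H, D)` on the instances `xs a, xs (a + 1), …`
that updates exactly in the rounds belonging to `U`. -/
noncomputable def soaRun [Nonempty Y] (H : Set (X → Y)) (D : ℕ) (xs : ℕ → X) (U : Set ℕ) (a : ℕ) :
    ℕ → Set (X → Y) × ℕ
  | 0 => (H, D)
  | n + 1 => if a + n ∈ U then soaUpdate (soaRun H D xs U a n) (xs (a + n))
      else soaRun H D xs U a n

open Classical in
/-- The run of the standard optimal algorithm that updates whenever it disagrees with `h`. -/
noncomputable def soaRunAgainst [Nonempty Y] (H : Set (X → Y)) (D : ℕ) (xs : ℕ → X) (h : X → Y)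
    (a : ℕ) : ℕ → Set (X → Y) × ℕ
  | 0 => (H, D)
  | n + 1 => if soaLabel (soaRunAgainst H D xs h a n) (xs (a + n)) ≠ h (xs (a + n))
      then soaUpdate (soaRunAgainst H D xs h a n) (xs (a + n))
      else soaRunAgainst H D xs h a n

open Classical in
/-- The rounds among `a, …, a + n - 1` in which `soaRunAgainst` disagrees with `h`. -/
noncomputable def soaErrors [Nonempty Y] (H : Set (X → Y)) (D : ℕ) (xs : ℕ → X) (h : X → Y)
    (a n : ℕ) : Finset ℕ :=
  {t ∈ Finset.Ico a (a + n) | soaLabel (soaRunAgainst H D xs h a (t - a)) (xs t) ≠ h (xs t)}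

variable [Nonempty Y] {H : Set (X → Y)} {D : ℕ}

theorem soaRunAgainst_spec (hD : ¬ ShattersDepth H D) (xs : ℕ → X) {h : X → Y} (hh : h ∈ H)
    (a n : ℕ) :
    h ∈ (soaRunAgainst H D xs h a n).1 ∧
      ¬ ShattersDepth (soaRunAgainst H D xs h a n).1 (soaRunAgainst H D xs h a n).2 ∧
      (soaErrors H D xs h a n).card + (soaRunAgainst H D xs h a n).2 = D := by
  classical
  induction n with
  | zero => exact ⟨hh, hD, by simp [soaErrors, soaRunAgainst]⟩
  | succ n ih =>
    obtain ⟨h1, h2, h3⟩ := ih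
    have herr : soaErrors H D xs h a (n + 1)
        = if soaLabel (soaRunAgainst H D xs h a n) (xs (a + n)) ≠ h (xs (a + n))
          then insert (a + n) (soaErrors H D xs h a n) else soaErrors H D xs h a n := by
      unfold soaErrors
      rw [← add_assoc, ← Finset.insert_Ico_right_eq_Ico_add_one (Nat.le_add_right a n),
        Finset.filter_insert, Nat.add_sub_cancel_left]
    have hnot : a + n ∉ soaErrors H D xs h a n := by simp [soaErrors]
    rw [herr, soaRunAgainst]
    split_ifs with hc
    · obtain ⟨h4, h5⟩ := not_shattersDepth_soaUpdate h2 h1 (xs (a + n))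
      refine ⟨⟨h1, Ne.symm hc⟩, h5, ?_⟩
      rw [Finset.card_insert_of_notMem hnot]
      omega
    · exact ⟨h1, h2, h3⟩

/-- For each hypothesis `h` some set of at most `D` update rounds makes the standard optimal
algorithm agree with `h` in all other rounds of a block. The set is given by an enumeration, which
uses the round after the block as a filler. -/
theorem exists_update_rounds (hD : ¬ ShattersDepth H D) (xs : ℕ → X) {h : X → Y} (hh : h ∈ H)
    (a n : ℕ) :
    ∃ e : Fin D → ℕ, (∀ i, e i ∈ Finset.Icc a (a + n)) ∧ ∃ U : Finset ℕ, U.card ≤ D ∧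
      ∀ j < n, a + j ∉ U →
        soaLabel (soaRun H D xs (Set.range e) a j) (xs (a + j)) = h (xs (a + j)) := by
  classical
  set U := soaErrors H D xs h a n with hU
  have hcard : U.card ≤ D := by
    have := (soaRunAgainst_spec hD xs hh a n).2.2
    rw [← hU] at this
    omega
  obtain ⟨e, he, he'⟩ := exists_enumeration U hcard (a + n)
  have hUI : ∀ t ∈ U, t ∈ Finset.Ico a (a + n) := fun t ht => (Finset.mem_filter.1 ht).1
  have hmem : ∀ j < n, a + j ∈ Set.range e ↔
      soaLabel (soaRunAgainst H D xs h a j) (xs (a + j)) ≠ h (xs (a + j)) := by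
    intro j hj
    have h1 : a + j ∈ U ↔
        soaLabel (soaRunAgainst H D xs h a j) (xs (a + j)) ≠ h (xs (a + j)) := by
      rw [hU, soaErrors, Finset.mem_filter, Nat.add_sub_cancel_left]
      simp [hj]
    rw [← h1]
    constructor
    · rintro ⟨i, hi⟩
      rcases he' i with hz | hz
      · omega
      · rwa [hi] at hz
    · exact fun ht => he _ ht
  have hrun : ∀ j ≤ n, soaRun H D xs (Set.range e) a j = soaRunAgainst H D xs h a j := by
    intro j
    induction j with
    | zero => intro _; rfl
    | succ j ih =>
      intro hj
      rw [soaRun, soaRunAgainst, ih (by omega)]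
      simp only [hmem j (by omega)]
  refine ⟨e, fun i => ?_, U, hcard, fun j hj hjU => ?_⟩
  · rcases he' i with hz | hz
    · rw [hz]; simp
    · have := hUI _ hz
      simp only [Finset.mem_Ico] at this
      simp only [Finset.mem_Icc]
      omega
  · rw [hrun j hj.le]
    by_contra hne
    obtain ⟨i, hi⟩ := (hmem j hj).2 hne
    rcases he' i with hz | hz
    · omega
    · exact hjU (hi ▸ hz)

end StandardOptimalAlgorithm

/-! ### Exponential weights over update schedules, in epochs -/

section Epochs

variable {X : Type u} {Y : Type v}

/-- The state of the epoch algorithm. Experts are indexed by enumerations of their update rounds;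
for each of them the state of its standard optimal algorithm and its log-weight are kept. -/
abbrev EpochState (X : Type u) (Y : Type v) (D : ℕ) : Type (max u v) :=
  ((Fin D → ℕ) → Set (X → Y) × ℕ) × ((Fin D → ℕ) → ℝ)

/-- The experts of epoch `k`, which lasts from round `k ^ 2` until just before round
`(k + 1) ^ 2`. -/
def epochExperts (D k : ℕ) : Finset (Fin D → ℕ) :=
  Fintype.piFinset fun _ => Finset.Icc (k ^ 2) ((k + 1) ^ 2)

theorem epochExperts_nonempty (D k : ℕ) : (epochExperts D k).Nonempty :=
  ⟨fun _ => k ^ 2, by simp [epochExperts]; intro _; gcongr; omega⟩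

theorem card_epochExperts (D k : ℕ) : (epochExperts D k).card = (2 * k + 2) ^ D := by
  simp only [epochExperts, Fintype.card_piFinset, Nat.card_Icc, Finset.prod_const,
    Finset.card_univ, Fintype.card_fin]
  congr 1
  have : (k + 1) ^ 2 = k ^ 2 + 2 * k + 1 := by ring
  omega

/-- The learning rate of epoch `k`. -/
noncomputable def epochRate (k : ℕ) : ℝ := 1 / √((k : ℝ) + 1)

theorem epochRate_pos (k : ℕ) : 0 < epochRate k := by unfold epochRate; positivity

/-- The state at the beginning of every epoch. -/
def freshState (H : Set (X → Y)) (D : ℕ) : EpochState X Y D := (fun _ => (H, D), 0)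

/-- The state used in round `t`: it is reset when a new epoch begins. -/
def resetState (H : Set (X → Y)) (D t : ℕ) (s : EpochState X Y D) : EpochState X Y D :=
  if t.sqrt ^ 2 = t then freshState H D else s

variable [Nonempty Y]

/-- The index of the label advised by the expert `e` (arbitrary if the label has no index). -/
noncomputable def expertAdvice {D : ℕ} [NeZero D] (label : X → Fin D → Y)
    (s : EpochState X Y D) (x : X) (e : Fin D → ℕ) : Fin D :=
  Classical.epsilon fun a => label x a = soaLabel (s.1 e) x

open Classical in
/-- The state after round `t` of epoch `k`: experts update in their update rounds, and log-weights
are charged after a mistake. -/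
noncomputable def epochStep {D : ℕ} [NeZero D] (label : X → Fin D → Y) (k t : ℕ)
    (s : EpochState X Y D) (x : X) (a : Fin D) (b : Bool) : EpochState X Y D :=
  (fun e => if t ∈ Set.range e then soaUpdate (s.1 e) x else s.1 e,
    if b then chargeAdvice (epochRate k) (epochExperts D k) s.2 (expertAdvice label s x) a else s.2)

/-- Exponential weights over update schedules, restarted at every square round. -/
noncomputable def epochAlgorithm (H : Set (X → Y)) {D : ℕ} [NeZero D] (label : X → Fin D → Y) :
    StateAlgorithm X Y D (EpochState X Y D) where
  init := freshState H D
  step t s := epochStep label t.sqrt t (resetState H D t s)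
  law t s x := ⟨adviceShare (epochExperts D t.sqrt) (resetState H D t s).2
      (expertAdvice label (resetState H D t s) x),
    adviceShare_mem_stdSimplex (epochExperts_nonempty D _) _ _⟩
  label := label

theorem sqrt_sq_add {k n : ℕ} (hn : n ≤ 2 * k) : (k ^ 2 + n).sqrt = k := by
  rw [pow_two]
  exact Nat.sqrt_add_eq k (by omega)

/-- The state used in round `k ^ 2 + n`, for `n` inside epoch `k`; for `n = 2 * k + 1` it is the
state at the end of the epoch. -/
noncomputable def epochState (H : Set (X → Y)) {D : ℕ} [NeZero D] (label : X → Fin D → Y)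
    (S : ℕ → X × Y) (k n : ℕ) (ω : ℕ → RoundSeed.{w}) : EpochState X Y D :=
  if n = 0 then freshState H D else (epochAlgorithm H label).playState S (k ^ 2 + n) ω

variable {H : Set (X → Y)} {D : ℕ} [NeZero D] {label : X → Fin D → Y}

theorem resetState_playState (S : ℕ → X × Y) {k n : ℕ} (hn : n ≤ 2 * k)
    (ω : ℕ → RoundSeed.{w}) :
    resetState H D (k ^ 2 + n) ((epochAlgorithm H label).playState S (k ^ 2 + n) ω)
      = epochState H label S k n ω := by
  unfold resetState epochState
  rw [sqrt_sq_add hn]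
  by_cases h : n = 0
  · simp [h]
  · rw [if_neg h, if_neg (by omega)]

open Classical in
theorem epochState_succ (S : ℕ → X × Y) {k n : ℕ} (hn : n ≤ 2 * k) (ω : ℕ → RoundSeed.{w}) :
    epochState H label S k (n + 1) ω
      = epochStep label k (k ^ 2 + n) (epochState H label S k n ω) (S (k ^ 2 + n)).1
        ((epochAlgorithm H label).draw ω (k ^ 2 + n)
          ((epochAlgorithm H label).playState S (k ^ 2 + n) ω) (S (k ^ 2 + n)).1)
        (decide (label (S (k ^ 2 + n)).1 ((epochAlgorithm H label).draw ω (k ^ 2 + n)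
          ((epochAlgorithm H label).playState S (k ^ 2 + n) ω) (S (k ^ 2 + n)).1)
            ≠ (S (k ^ 2 + n)).2)) := by
  rw [epochState, if_neg (Nat.succ_ne_zero n), ← add_assoc, StateAlgorithm.playState_succ,
    ← resetState_playState S hn]
  change epochStep label (k ^ 2 + n).sqrt _ _ _ _ _ = _
  rw [sqrt_sq_add hn]
  rfl

/-- The version spaces of the experts do not depend on the learner's randomness. -/
theorem epochState_fst (S : ℕ → X × Y) {k n : ℕ} (hn : n ≤ 2 * k + 1) (ω : ℕ → RoundSeed.{w})
    (e : Fin D → ℕ) :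
    (epochState H label S k n ω).1 e
      = soaRun H D (fun t => (S t).1) (Set.range e) (k ^ 2) n := by
  classical
  induction n with
  | zero => rfl
  | succ n ih =>
    rw [epochState_succ S (by omega), soaRun, ← ih (by omega)]
    simp only [epochStep]
    congr

/-- The index advised in round `k ^ 2 + n` by an expert of epoch `k`. -/
noncomputable def scheduleAdvice (H : Set (X → Y)) {D : ℕ} [NeZero D] (label : X → Fin D → Y)
    (S : ℕ → X × Y) (k : ℕ) (e : Fin D → ℕ) (n : ℕ) : Fin D :=
  Classical.epsilon fun a => label (S (k ^ 2 + n)).1 a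
    = soaLabel (soaRun H D (fun t => (S t).1) (Set.range e) (k ^ 2) n) (S (k ^ 2 + n)).1

theorem expertAdvice_epochState (S : ℕ → X × Y) {k n : ℕ} (hn : n ≤ 2 * k)
    (ω : ℕ → RoundSeed.{w}) (e : Fin D → ℕ) :
    expertAdvice label (epochState H label S k n ω) (S (k ^ 2 + n)).1 e
      = scheduleAdvice H label S k e n := by
  rw [expertAdvice, epochState_fst S (by omega), scheduleAdvice]

open Classical in
/-- One round of the epoch algorithm, in expectation. -/
theorem mistakeProb_add_potential_le (S : ℕ → X × Y) {k n : ℕ} (hn : n ≤ 2 * k)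
    {e : Fin D → ℕ} (he : e ∈ epochExperts D k) :
    ((epochAlgorithm H label).toLearner : BanditLearner.{u, v, w} X Y).mistakeProb S (k ^ 2 + n)
        + ∫ ω, hedgePotential (epochRate k) (epochExperts D k)
            (epochState H label S k (n + 1) ω).2 e ∂seedLaw.{w}
      ≤ (if label (S (k ^ 2 + n)).1 (scheduleAdvice H label S k e n) ≠ (S (k ^ 2 + n)).2
          then 1 else 0)
        + ∫ ω, hedgePotential (epochRate k) (epochExperts D k)
            (epochState H label S k n ω).2 e ∂seedLaw.{w}
        + epochRate k * D := by
  set t := k ^ 2 + n with ht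
  set 𝔄 := epochAlgorithm H label with h𝔄
  set x := (S t).1 with hx
  set c : Fin D → Prop := fun a => label x a ≠ (S t).2 with hc
  set η := epochRate k with hη
  set E := epochExperts D k with hE
  let F₁ : EpochState X Y D → Fin D → ℝ := fun _ a => if c a then 1 else 0
  let F₂ : EpochState X Y D → Fin D → ℝ := fun s a =>
    hedgePotential η E (epochStep label k t (resetState H D t s) x a (decide (c a))).2 e
  have h1 : 𝔄.toLearner.mistakeProb S t
      = ∫ ω, F₁ (𝔄.playState S t ω) (𝔄.draw ω t (𝔄.playState S t ω) x) ∂seedLaw.{w} :=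
    𝔄.mistakeProb_toLearner S t
  have h2 : ∀ ω : ℕ → RoundSeed.{w},
      hedgePotential η E (epochState H label S k (n + 1) ω).2 e
        = F₂ (𝔄.playState S t ω) (𝔄.draw ω t (𝔄.playState S t ω) x) := by
    intro ω
    rw [epochState_succ S hn, ← resetState_playState S hn]
  simp_rw [h2]
  rw [h1, ← integral_add (𝔄.integrable_playState_draw S t F₁) (𝔄.integrable_playState_draw S t F₂),
    𝔄.integral_playState_draw S t fun s a => F₁ s a + F₂ s a]
  have hint : Integrable (fun ω => hedgePotential η E (epochState H label S k n ω).2 e)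
      seedLaw.{w} := by
    simp_rw [← resetState_playState S hn]
    exact 𝔄.integrable_playState S t fun s => hedgePotential η E (resetState H D t s).2 e
  have hR : (if label x (scheduleAdvice H label S k e n) ≠ (S t).2 then (1 : ℝ) else 0)
        + ∫ ω, hedgePotential η E (epochState H label S k n ω).2 e ∂seedLaw.{w} + η * D
      = ∫ ω, ((if label x (scheduleAdvice H label S k e n) ≠ (S t).2 then (1 : ℝ) else 0)
        + hedgePotential η E (epochState H label S k n ω).2 e + η * D) ∂seedLaw.{w} := by
    simp_rw [add_right_comm _ _ (η * (D : ℝ))]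
    rw [integral_add (integrable_const _) hint]
    simp
  rw [hR]
  refine integral_mono (𝔄.integrable_playState S t
    (fun s => ∑ a, (𝔄.law t s x).1 a * (F₁ s a + F₂ s a)))
    (((integrable_const _).add hint).add (integrable_const _)) fun ω => ?_
  dsimp only
  have hround := sum_adviceShare_mul_le (epochRate_pos k) (epochState H label S k n ω).2
    (expertAdvice label (epochState H label S k n ω) x) he c
  rw [expertAdvice_epochState S hn] at hround
  refine le_trans (le_of_eq (Finset.sum_congr rfl fun a _ => ?_)) hround
  have hlaw : (𝔄.law t (𝔄.playState S t ω) x).1 a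
      = adviceShare E (epochState H label S k n ω).2
        (expertAdvice label (epochState H label S k n ω) x) a := by
    rw [← resetState_playState S hn]
    simp only [h𝔄, epochAlgorithm, ht, sqrt_sq_add hn]
    rfl
  rw [hlaw]
  simp only [F₁, F₂, epochStep, decide_eq_true_eq, ht, h𝔄, resetState_playState S hn]
  rfl

/-- The regret bound of epoch `k`. -/
noncomputable def epochBound (D k : ℕ) : ℝ :=
  D + Real.log ((2 * k + 2 : ℝ) ^ D) / epochRate k + epochRate k * D * (2 * k + 1)

open Classical in
/-- The regret with respect to an expert in the first `n` rounds of epoch `k`. -/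
theorem sum_mistakeProb_epoch_le_expert (S : ℕ → X × Y) {k n : ℕ} (hn : n ≤ 2 * k + 1)
    {e : Fin D → ℕ} (he : e ∈ epochExperts D k) :
    ∑ j ∈ Finset.range n, ((epochAlgorithm H label).toLearner :
        BanditLearner.{u, v, w} X Y).mistakeProb S (k ^ 2 + j)
      ≤ ∑ j ∈ Finset.range n, (if label (S (k ^ 2 + j)).1 (scheduleAdvice H label S k e j)
          ≠ (S (k ^ 2 + j)).2 then (1 : ℝ) else 0)
        + Real.log ((2 * k + 2 : ℝ) ^ D) / epochRate k + epochRate k * D * n := by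
  have key : ∑ j ∈ Finset.range n, ((epochAlgorithm H label).toLearner :
        BanditLearner.{u, v, w} X Y).mistakeProb S (k ^ 2 + j)
        + ∫ ω, hedgePotential (epochRate k) (epochExperts D k)
            (epochState H label S k n ω).2 e ∂seedLaw.{w}
      ≤ ∑ j ∈ Finset.range n, (if label (S (k ^ 2 + j)).1 (scheduleAdvice H label S k e j)
          ≠ (S (k ^ 2 + j)).2 then (1 : ℝ) else 0)
        + Real.log ((2 * k + 2 : ℝ) ^ D) / epochRate k + epochRate k * D * n := by
    induction n with
    | zero =>
      have hfresh : ∀ ω : ℕ → RoundSeed.{w}, hedgePotential (epochRate k) (epochExperts D k)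
          (epochState H label S k 0 ω).2 e = Real.log ((2 * k + 2 : ℝ) ^ D) / epochRate k := by
        intro ω
        simp [epochState, freshState, hedgePotential, card_epochExperts]
      simp [hfresh]
    | succ n ih =>
      have h1 := ih (by omega)
      have h2 := mistakeProb_add_potential_le.{u, v, w} (H := H) (label := label) S
        (k := k) (n := n) (by omega) he
      rw [Finset.sum_range_succ, Finset.sum_range_succ]
      push_cast
      linarith
  have hnonneg : 0 ≤ ∫ ω, hedgePotential (epochRate k) (epochExperts D k)
      (epochState H label S k n ω).2 e ∂seedLaw.{w} :=
    integral_nonneg fun ω => hedgePotential_nonneg (epochRate_pos k) _ he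
  linarith

open Classical in
/-- The regret with respect to a hypothesis in the first `n` rounds of epoch `k`. -/
theorem sum_mistakeProb_epoch_le (hD : ¬ ShattersDepth H D)
    (hlabel : ∀ x, ∀ h ∈ H, ∃ a, label x a = h x) (S : ℕ → X × Y) {k n : ℕ}
    (hn : n ≤ 2 * k + 1) {h : X → Y} (hh : h ∈ H) :
    ∑ j ∈ Finset.range n, ((epochAlgorithm H label).toLearner :
        BanditLearner.{u, v, w} X Y).mistakeProb S (k ^ 2 + j)
      ≤ ∑ j ∈ Finset.range n, (if h (S (k ^ 2 + j)).1 ≠ (S (k ^ 2 + j)).2 then (1 : ℝ) else 0)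
        + epochBound D k := by
  obtain ⟨e, he, U, hU, hagree⟩ := exists_update_rounds hD (fun t => (S t).1) hh (k ^ 2) (2 * k + 1)
  have heE : e ∈ epochExperts D k := by
    rw [epochExperts, Fintype.mem_piFinset]
    intro i
    have := he i
    rwa [show k ^ 2 + (2 * k + 1) = (k + 1) ^ 2 by ring] at this
  refine (sum_mistakeProb_epoch_le_expert S hn heE).trans ?_
  have h1 : ∀ j ∈ Finset.range n,
      (if label (S (k ^ 2 + j)).1 (scheduleAdvice H label S k e j)
        ≠ (S (k ^ 2 + j)).2 then (1 : ℝ) else 0)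
      ≤ (if h (S (k ^ 2 + j)).1 ≠ (S (k ^ 2 + j)).2 then (1 : ℝ) else 0)
        + if k ^ 2 + j ∈ U then 1 else 0 := by
    intro j hj
    have hj' := Finset.mem_range.1 hj
    by_cases hjU : k ^ 2 + j ∈ U
    · rw [if_pos hjU]
      split_ifs <;> norm_num
    · have hsoa := hagree j (by omega) hjU
      have hadv : label (S (k ^ 2 + j)).1 (scheduleAdvice H label S k e j)
          = h (S (k ^ 2 + j)).1 := by
        unfold scheduleAdvice
        rw [hsoa]
        exact Classical.epsilon_spec (hlabel _ h hh)
      rw [hadv, if_neg hjU, add_zero]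
  have h2 : ∑ j ∈ Finset.range n, (if k ^ 2 + j ∈ U then (1 : ℝ) else 0) ≤ D := by
    rw [Finset.sum_boole]
    have : ((Finset.range n).filter fun j => k ^ 2 + j ∈ U).card ≤ U.card :=
      Finset.card_le_card_of_injOn (fun j => k ^ 2 + j)
        (fun j hj => (Finset.mem_filter.1 hj).2) fun i _ j _ hij => by simpa using hij
    exact_mod_cast this.trans hU
  have h3 := Finset.sum_le_sum h1
  rw [Finset.sum_add_distrib] at h3
  have h4 : epochRate k * D * n ≤ epochRate k * D * (2 * k + 1) := by
    have : (n : ℝ) ≤ 2 * k + 1 := by exact_mod_cast hn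
    have := (epochRate_pos k).le
    gcongr
  unfold epochBound
  linarith

theorem epochBound_nonneg (D k : ℕ) : 0 ≤ epochBound D k := by
  have h1 := epochRate_pos k
  have h2 : 0 ≤ Real.log ((2 * k + 2 : ℝ) ^ D) :=
    Real.log_nonneg (one_le_pow₀ (by have : (0 : ℝ) ≤ k := k.cast_nonneg; linarith))
  unfold epochBound
  positivity

/-- The regret of the epoch algorithm with respect to a hypothesis. -/
theorem sum_mistakeProb_le (hD : ¬ ShattersDepth H D)
    (hlabel : ∀ x, ∀ h ∈ H, ∃ a, label x a = h x) (S : ℕ → X × Y) (T : ℕ) {h : X → Y}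
    (hh : h ∈ H) :
    ∑ t ∈ Finset.range T, ((epochAlgorithm H label).toLearner :
        BanditLearner.{u, v, w} X Y).mistakeProb S t
      ≤ hypothesisLoss S h T + ∑ j ∈ Finset.range (T.sqrt + 1), epochBound D j := by
  classical
  have hsq : ∀ k : ℕ, ∑ t ∈ Finset.range (k ^ 2), ((epochAlgorithm H label).toLearner :
        BanditLearner.{u, v, w} X Y).mistakeProb S t
      ≤ hypothesisLoss S h (k ^ 2) + ∑ j ∈ Finset.range k, epochBound D j := by
    intro k
    induction k with
    | zero => simp [hypothesisLoss]
    | succ k ih =>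
      have h1 := sum_mistakeProb_epoch_le.{u, v, w} hD hlabel S (k := k) (n := 2 * k + 1) le_rfl hh
      rw [show (k + 1) ^ 2 = k ^ 2 + (2 * k + 1) by ring]
      unfold hypothesisLoss at ih ⊢
      rw [Finset.sum_range_add _ (k ^ 2), Finset.sum_range_add _ (k ^ 2),
        Finset.sum_range_succ (epochBound D)]
      linarith
  obtain ⟨n, hn⟩ : ∃ n, T = T.sqrt ^ 2 + n :=
    Nat.exists_eq_add_of_le (by rw [pow_two]; exact Nat.sqrt_le T)
  have hn2 : n ≤ 2 * T.sqrt + 1 := by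
    have := Nat.sqrt_le_add T
    rw [← pow_two] at this
    omega
  have h1 := sum_mistakeProb_epoch_le.{u, v, w} hD hlabel S hn2 hh
  have h2 := hsq T.sqrt
  rw [Finset.sum_range_succ]
  generalize T.sqrt = k at *
  subst hn
  unfold hypothesisLoss at h2 ⊢
  rw [Finset.sum_range_add, Finset.sum_range_add]
  linarith

theorem regret_epochAlgorithm_le (hH : H.Nonempty) (hD : ¬ ShattersDepth H D)
    (hlabel : ∀ x, ∀ h ∈ H, ∃ a, label x a = h x) (T : ℕ) :
    ((epochAlgorithm H label).toLearner : BanditLearner.{u, v, w} X Y).regret H T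
      ≤ ∑ j ∈ Finset.range (T.sqrt + 1), epochBound D j := by
  have : Nonempty H := hH.to_subtype
  refine Real.iSup_le (fun S => ?_) (Finset.sum_nonneg fun j _ => epochBound_nonneg D j)
  rw [BanditLearner.expectedRegret_eq, sub_le_iff_le_add, ← sub_le_iff_le_add']
  exact le_ciInf fun h => by
    have := sum_mistakeProb_le.{u, v, w} hD hlabel S T h.2
    linarith

end Epochs

/-! ### Sublinearity -/

theorem isLittleO_epochBound (D : ℕ) :
    epochBound D =o[atTop] fun k : ℕ => (k : ℝ) + 1 := by
  have hk1 : Tendsto (fun k : ℕ => (k : ℝ) + 1) atTop atTop :=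
    tendsto_atTop_add_const_right _ _ tendsto_natCast_atTop_atTop
  have hsqrt : Tendsto (fun k : ℕ => √((k : ℝ) + 1)) atTop atTop :=
    Real.tendsto_sqrt_atTop.comp hk1
  have hconst : ∀ c : ℝ, (fun _ : ℕ => c) =o[atTop] fun k : ℕ => (k : ℝ) + 1 := fun c =>
    isLittleO_const_left.2 (Or.inr (tendsto_norm_atTop_atTop.comp hk1))
  have hroot : (fun k : ℕ => √((k : ℝ) + 1)) =o[atTop] fun k : ℕ => (k : ℝ) + 1 := by
    have h1 : (fun k : ℕ => (1 : ℝ)) =o[atTop] fun k : ℕ => √((k : ℝ) + 1) :=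
      isLittleO_const_left.2 (Or.inr (tendsto_norm_atTop_atTop.comp hsqrt))
    have h2 := h1.mul_isBigO (isBigO_refl (fun k : ℕ => √((k : ℝ) + 1)) atTop)
    refine h2.congr (fun k => one_mul _) fun k => Real.mul_self_sqrt (by positivity)
  have hlog : (fun k : ℕ => Real.log ((k : ℝ) + 1) * √((k : ℝ) + 1)) =o[atTop]
      fun k : ℕ => (k : ℝ) + 1 := by
    have h1 : (fun k : ℕ => Real.log ((k : ℝ) + 1)) =o[atTop] fun k : ℕ => √((k : ℝ) + 1) := by
      have := (isLittleO_log_rpow_atTop (show (0 : ℝ) < 1 / 2 by norm_num)).comp_tendsto hk1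
      simpa [Function.comp_def, Real.sqrt_eq_rpow] using this
    have h2 := h1.mul_isBigO (isBigO_refl (fun k : ℕ => √((k : ℝ) + 1)) atTop)
    exact h2.congr (fun k => rfl) fun k => Real.mul_self_sqrt (by positivity)
  have hsplit : epochBound D = fun k : ℕ => D
      + ((D * Real.log 2) * √((k : ℝ) + 1)
      + D * (Real.log ((k : ℝ) + 1) * √((k : ℝ) + 1)))
      + epochRate k * D * (2 * k + 1) := by
    funext k
    have hk : (0 : ℝ) < (k : ℝ) + 1 := by positivity
    rw [epochBound, Real.log_pow, show (2 * k + 2 : ℝ) = 2 * (k + 1) by ring,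
      Real.log_mul (by norm_num) hk.ne', epochRate, one_div, div_inv_eq_mul]
    ring
  rw [hsplit]
  refine ((hconst D).add ((hroot.const_mul_left _).add (hlog.const_mul_left _))).add ?_
  refine IsBigO.trans_isLittleO (IsBigO.of_bound (2 * D) (Eventually.of_forall fun k => ?_)) hroot
  have hk : (0 : ℝ) < √((k : ℝ) + 1) := by positivity
  have hss : √((k : ℝ) + 1) * √((k : ℝ) + 1) = (k : ℝ) + 1 := Real.mul_self_sqrt (by positivity)
  rw [Real.norm_of_nonneg (by have := epochRate_pos k; positivity), Real.norm_of_nonneg hk.le,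
    epochRate, mul_assoc, one_div_mul_eq_div, div_le_iff₀ hk]
  rw [mul_assoc, hss]
  have : (0 : ℝ) ≤ D := D.cast_nonneg
  nlinarith

theorem isLittleO_sum_epochBound (D : ℕ) :
    (fun T : ℕ => ∑ j ∈ Finset.range (T.sqrt + 1), epochBound D j) =o[atTop]
      fun T : ℕ => (T : ℝ) := by
  have hbig : Tendsto (fun n => ∑ i ∈ Finset.range n, ((i : ℝ) + 1)) atTop atTop := by
    refine tendsto_atTop_mono (fun n => ?_) tendsto_natCast_atTop_atTop
    calc (n : ℝ) = ∑ i ∈ Finset.range n, (1 : ℝ) := by simp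
      _ ≤ _ := Finset.sum_le_sum fun i _ => by
        have : (0 : ℝ) ≤ i := i.cast_nonneg
        linarith
  have h1 := (isLittleO_epochBound D).sum_range (fun k => by positivity) hbig
  have hsqrt : Tendsto (fun T : ℕ => T.sqrt + 1) atTop atTop := by
    refine tendsto_atTop_atTop.2 fun b => ⟨b ^ 2, fun T hT => ?_⟩
    have := Nat.sqrt_le_sqrt hT
    rw [pow_two, Nat.sqrt_eq] at this
    omega
  refine (h1.comp_tendsto hsqrt).trans_isBigO (IsBigO.of_bound 4 ?_)
  filter_upwards [eventually_ge_atTop 1] with T hT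
  have hs1 : 1 ≤ T.sqrt := Nat.le_sqrt.2 (by simpa using hT)
  have hs2 : T.sqrt * T.sqrt ≤ T := Nat.sqrt_le T
  have hs1' : (1 : ℝ) ≤ T.sqrt := by exact_mod_cast hs1
  have hs2' : (T.sqrt : ℝ) * T.sqrt ≤ T := by exact_mod_cast hs2
  rw [Function.comp_apply, Real.norm_of_nonneg (Finset.sum_nonneg fun i _ => by positivity),
    Real.norm_of_nonneg (Nat.cast_nonneg T)]
  calc ∑ i ∈ Finset.range (T.sqrt + 1), ((i : ℝ) + 1)
      ≤ ∑ i ∈ Finset.range (T.sqrt + 1), ((T.sqrt : ℝ) + 1) := by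
        refine Finset.sum_le_sum fun i hi => ?_
        have : (i : ℝ) ≤ T.sqrt := by
          exact_mod_cast Nat.lt_succ_iff.1 (Finset.mem_range.1 hi)
        linarith
    _ = ((T.sqrt : ℝ) + 1) * (T.sqrt + 1) := by simp; ring
    _ ≤ 4 * T := by nlinarith

section Learnability

variable {X : Type u} {Y : Type v} {H : Set (X → Y)}

theorem BanditLearner.regret_nonneg (A : BanditLearner.{u, v, w} X Y) (hH : H.Nonempty) (T : ℕ) :
    0 ≤ A.regret H T := by
  refine le_trans (le_of_eq ?_) (A.monotone_regret hH (Nat.zero_le T))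
  simp [BanditLearner.regret, BanditLearner.expectedRegret]

theorem learnable_of_not_shattersDepth (hH : H.Nonempty) {D : ℕ} (hD : ¬ ShattersDepth H D) :
    BanditOnlineLearnable.{u, v, w} H := by
  suffices h : ∃ A : BanditLearner.{u, v, w} X Y, (A.regret H) =o[atTop] fun T : ℕ => (T : ℝ) by
    obtain ⟨A, hA⟩ := h
    exact ⟨A, A.monotone_regret hH, hA⟩
  rcases isEmpty_or_nonempty X with hX | ⟨⟨x₀⟩⟩
  · -- Without instances there are no streams, and the supremum over streams is `0`.
    refine ⟨⟨PUnit, ⊤, Measure.dirac PUnit.unit, inferInstance, fun _ _ x => hX.elim x,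
      fun _ x => hX.elim x⟩, ?_⟩
    have hE : IsEmpty (ℕ → X × Y) := ⟨fun S => hX.elim (S 0).1⟩
    have h0 : ∀ A : BanditLearner.{u, v, w} X Y, A.regret H = fun _ => 0 := fun A => by
      funext T
      simp [BanditLearner.regret]
    rw [h0]
    exact isLittleO_zero _ _
  have hY : Nonempty Y := ⟨hH.some x₀⟩
  have hD0 : NeZero D := ⟨by rintro rfl; exact hD hH⟩
  have hlabel : ∀ x, ∃ l : Fin D → Y, ∀ h ∈ H, ∃ a, l a = h x := by
    intro x
    have hcard := encard_image_eval_le hD x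
    have hfin := Set.finite_of_encard_le_coe hcard
    rw [hfin.encard_eq_coe_toFinset_card] at hcard
    obtain ⟨l, hl, -⟩ := exists_enumeration hfin.toFinset (by exact_mod_cast hcard)
      (Classical.arbitrary Y)
    exact ⟨l, fun h hh => hl _ (hfin.mem_toFinset.2 ⟨h, hh, rfl⟩)⟩
  choose label hlabel using hlabel
  refine ⟨(epochAlgorithm H label).toLearner, ?_⟩
  refine IsBigO.trans_isLittleO (IsBigO.of_bound 1 (Eventually.of_forall fun T => ?_))
    (isLittleO_sum_epochBound D)
  have h1 := regret_epochAlgorithm_le.{u, v, w} hH hD hlabel T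
  have h2 := BanditLearner.regret_nonneg
    ((epochAlgorithm H label).toLearner : BanditLearner.{u, v, w} X Y) hH T
  rw [one_mul, Real.norm_of_nonneg h2, Real.norm_of_nonneg (h2.trans h1)]
  exact h1

end Learnability

theorem theorem1 {X : Type u} {Y : Type v} (H : Set (X → Y)) (hH : H.Nonempty) :
    BanditOnlineLearnable.{u, v, w} H ↔ banditLittlestoneDim H < ⊤ := by
  rw [banditLittlestoneDim_lt_top_iff hH]
  exact ⟨exists_not_shattersDepth_of_learnable hH, fun ⟨_, hD⟩ =>
    learnable_of_not_shattersDepth hH hD⟩
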